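/- Let $F\subset\mathbb{R}^3$ be a compact orientable surface with boundary whose boundary $\partial F$ is (nonempty and) connected. Suppose that $F$ is built from $d$ disks and $b$ bands, that is, $F$ is the union of $d$ pairwise disjoint embedded closed disks and $b$ pairwise disjoint embedded bands $[0,1]\times[0,1]$, such that the short sides $\{0\}\times[0,1]$ and $\{1\}\times[0,1]$ of each band lie on the boundary circles of the disks and the bands do not meet the disks anywhere else. Then $$\chi(F)=d-b .$$ Here a surface is called orientable if it contains no embedded Möbius band, and $\chi(F)=V-A+C$, where $V$, $A$ and $C$ are the numbers of vertices, edges and faces of a polygonal presentation of $F$: finitely many polygons (closed disks whose boundary circle is divided into $n\ge 1$ sides) with oriented sides, some of which are matched in pairs, such that the space obtained by gluing matched sides compatibly with their orientations is homeomorphic to $F$. That is, $F$ has a polygonal presentation, and $V-A+C=d-b$ for every polygonal presentation of $F$. -/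

import Mathlib

open scoped Manifold

/-- Three-dimensional Euclidean space. -/
abbrev E3 : Type := EuclideanSpace ℝ (Fin 3)

/-- The closed unit disk `D²`. -/
abbrev Disk : Type := Metric.closedBall (0 : ℂ) 1

/-- The Möbius band: the rectangle `[0,10] × [0,1]` with `(0, y)` glued to `(10, 1 - y)`. -/
def MobiusBand : Type :=
  Quot (fun p q : Set.Icc (0 : ℝ) 10 × Set.Icc (0 : ℝ) 1 =>
    (p.1 : ℝ) = 0 ∧ (q.1 : ℝ) = 10 ∧ (q.2 : ℝ) = 1 - (p.2 : ℝ))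

instance : TopologicalSpace MobiusBand :=
  inferInstanceAs (TopologicalSpace (Quot _))

/-- A surface is orientable if it contains no Möbius band. -/
def IsOrientableSurface (X : Type*) [TopologicalSpace X] : Prop :=
  ¬ ∃ f : MobiusBand → X, Topology.IsEmbedding f

/-- A polygonal presentation: finitely many polygons, an orientation of each of their sides, and a
partial matching of the sides, given as an involution whose fixed points are the unmatched sides.
A polygon with `n ≥ 1` sides is the closed unit disk whose boundary circle is divided into `n` equal
arcs. -/
structure PolygonalPresentation where
  numFaces : ℕ
  sides : Fin numFaces → ℕ
  sides_ne_zero : ∀ i, NeZero (sides i)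
  /-- `true` means that the side is oriented counterclockwise. -/
  orientation : (Σ i, Fin (sides i)) → Bool
  pairing : (Σ i, Fin (sides i)) → (Σ i, Fin (sides i))
  pairing_involutive : Function.Involutive pairing

namespace PolygonalPresentation

variable (P : PolygonalPresentation)

instance (i : Fin P.numFaces) : NeZero (P.sides i) := P.sides_ne_zero i

/-- The sides of all the polygons, before gluing: side `k` of a polygon goes counterclockwise from
corner `k` to corner `k + 1` (cyclically). -/
abbrev Side : Type := Σ i, Fin (P.sides i)

/-- The corners of all the polygons, before gluing. -/
abbrev Corner : Type := Σ i, Fin (P.sides i)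

/-- The initial corner of a side, with respect to its chosen orientation. -/
def source (e : P.Side) : P.Corner :=
  if P.orientation e then e else ⟨e.1, e.2 + 1⟩

/-- The final corner of a side, with respect to its chosen orientation. -/
def target (e : P.Side) : P.Corner :=
  if P.orientation e then ⟨e.1, e.2 + 1⟩ else e

/-- The point of the unit circle with angle `2πs`, as a point of the closed disk. -/
noncomputable def circlePoint (s : ℝ) : Disk :=
  ⟨Complex.exp ((2 * Real.pi * s : ℝ) * Complex.I), by
    simp only [mem_closedBall_zero_iff, Complex.norm_exp_ofReal_mul_I, le_refl]⟩

/-- The point at time `t ∈ [0,1]` on a side, followed in its chosen orientation. -/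
noncomputable def sidePoint (e : P.Side) (t : unitInterval) : Σ _ : Fin P.numFaces, Disk :=
  ⟨e.1, circlePoint
    (((e.2 : ℕ) + (if P.orientation e then (t : ℝ) else 1 - (t : ℝ))) / (P.sides e.1 : ℝ))⟩

/-- The space presented by `P`: the disjoint union of the polygons, with each side glued to the side
it is matched with in such a way that the orientations agree. -/
def Realization : Type :=
  Quot (fun x y : (Σ _ : Fin P.numFaces, Disk) =>
    ∃ (e : P.Side) (t : unitInterval), x = P.sidePoint e t ∧ y = P.sidePoint (P.pairing e) t)

instance : TopologicalSpace P.Realization :=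
  inferInstanceAs (TopologicalSpace (Quot _))

/-- The vertices: the corners of the polygons, up to the identifications made by the gluing. -/
def Vertex : Type :=
  Quot (fun v w : P.Corner => ∃ e : P.Side,
    (v = P.source e ∧ w = P.source (P.pairing e)) ∨
    (v = P.target e ∧ w = P.target (P.pairing e)))

/-- The edges: the sides of the polygons, matched sides being identified. -/
def Edge : Type :=
  Quot (fun e e' : P.Side => e' = P.pairing e)

/-- `V - A + C`: the number of vertices, minus that of edges, plus that of faces. -/
noncomputable def eulerChar : ℤ :=
  (Nat.card P.Vertex : ℤ) - (Nat.card P.Edge : ℤ) + (P.numFaces : ℤ)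

/-- `P` is a polygonal presentation of the space `X`. -/
def Presents (X : Type*) [TopologicalSpace X] : Prop :=
  Nonempty (P.Realization ≃ₜ X)

end PolygonalPresentation

/-- `χ(X)` is well defined and equal to `n`: the space `X` has a polygonal presentation, and
every polygonal presentation of `X` satisfies `V - A + C = n`. -/
def HasEulerChar (X : Type*) [TopologicalSpace X] (n : ℤ) : Prop :=
  (∃ P : PolygonalPresentation, P.Presents X) ∧
    ∀ P : PolygonalPresentation, P.Presents X → P.eulerChar = n

/-- `F` is built from `d` disks and `b` bands: it is the union of `d` disjoint embedded disks and of
`b` disjoint embedded bands `[0,1] × [0,1]`, where the short sides `{0} × [0,1]` and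
`{1} × [0,1]` of the bands lie on the boundary circles of the disks and the bands do not meet the
disks anywhere else. -/
structure DiskBandDecomposition (F : Set E3) (d b : ℕ) where
  disk : Fin d → Disk → E3
  band : Fin b → unitInterval × unitInterval → E3
  isEmbedding_disk : ∀ i, Topology.IsEmbedding (disk i)
  isEmbedding_band : ∀ j, Topology.IsEmbedding (band j)
  disjoint_disks : ∀ i i', i ≠ i' → Disjoint (Set.range (disk i)) (Set.range (disk i'))
  disjoint_bands : ∀ j j', j ≠ j' → Disjoint (Set.range (band j)) (Set.range (band j'))
  short_side : ∀ (j : Fin b) (s t : unitInterval), s = 0 ∨ s = 1 →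
    ∃ (i : Fin d) (z : Disk), ‖(z : ℂ)‖ = 1 ∧ band j (s, t) = disk i z
  meets_only_short_side : ∀ (j : Fin b) (s t : unitInterval) (i : Fin d) (z : Disk),
    band j (s, t) = disk i z → s = 0 ∨ s = 1
  union_eq : F = (⋃ i, Set.range (disk i)) ∪ ⋃ j, Set.range (band j)

/-! There are two halves: `V - A + C` is a homeomorphism invariant, and one presentation read off
from the disks and bands has the value `d - b`.

For invariance, take `C(Y, ℤ)` as H⁰ of a space `Y`, and `C(Y, UnitAddCircle)` modulo the maps that
lift to `ℝ` as H¹; both depend only on `Y` up to homeomorphism. Remove from a realization finitely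
many points, at least one inside each polygon. This kills H², so that H⁰ and H¹ see the whole Euler
characteristic. Modulo liftable maps, a circle-valued map may be assumed to vanish at the vertices;
it then has winding numbers along the edges and around the punctures. For each polygon the winding
along the boundary equals the total winding around its punctures. There are no other relations, and
the liftable maps among those vanishing at the vertices give exactly the coboundaries of integer
functions on the vertices. Counting ranks (`cohomologyRank_punctured`) shows that rank H⁰ - rank H¹
is `V - A + C` minus the number of punctures. Given a homeomorphism of two realizations, the open
polygons have dense open union on either side, so a single finite set can puncture both
(`eulerChar_eq_of_homeomorph`).

For the value, turn disks and bands into polygons that have the short sides of the bands among their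
sides (`exists_polygon_parametrization`). Before gluing there are `d + b` faces and as many corners
as sides. Each of the `2b` gluings removes two vertices and one edge, which leaves `d + b - 2b`
(`exists_presentation_of_gluing`). -/

/-! ### Lifting circle-valued maps to the reals. -/

theorem UnitAddCircle.coe_eq_zero_iff_int {x : ℝ} :
    (x : UnitAddCircle) = 0 ↔ ∃ n : ℤ, (n : ℝ) = x := by
  rw [AddCircle.coe_eq_zero_iff]; simp

theorem UnitAddCircle.coe_eq_coe_iff_int {x y : ℝ} :
    (x : UnitAddCircle) = y ↔ ∃ n : ℤ, x = y + n := by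
  rw [← sub_eq_zero, ← AddCircle.coe_sub, UnitAddCircle.coe_eq_zero_iff_int]
  exact exists_congr fun n => ⟨fun h => by linarith, fun h => by linarith⟩

theorem UnitAddCircle.coe_intCast (n : ℤ) : ((n : ℝ) : UnitAddCircle) = 0 :=
  UnitAddCircle.coe_eq_zero_iff_int.2 ⟨n, rfl⟩

/-- Circle-valued maps on convex sets lift to real-valued maps. -/
theorem exists_real_lift_of_convex {E : Type*} [NormedAddCommGroup E] [NormedSpace ℝ E] {K : Set E}
    (hK : Convex ℝ K) {φ : E → UnitAddCircle} (hφ : ContinuousOn φ K) :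
    ∃ g : E → ℝ, ContinuousOn g K ∧ ∀ x ∈ K, φ x = (g x : UnitAddCircle) := by
  rcases K.eq_empty_or_nonempty with rfl | ⟨x₀, hx₀⟩
  · exact ⟨0, by simp, by simp⟩
  have hmem : ∀ p : unitInterval × K, x₀ + (p.1 : ℝ) • ((p.2 : E) - x₀) ∈ K := fun p =>
    hK.add_smul_sub_mem hx₀ p.2.2 p.1.2
  obtain ⟨a₀, ha₀⟩ : ∃ a : ℝ, (a : UnitAddCircle) = φ x₀ := QuotientAddGroup.mk_surjective _
  -- `K` contracts to `x₀` along segments. Homotopy lifting starts from the constant lift `a₀` at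
  -- time 0; at time 1 it yields the lift of `φ`.
  let H : C(unitInterval × K, UnitAddCircle) :=
    ⟨fun p => φ (x₀ + (p.1 : ℝ) • ((p.2 : E) - x₀)),
      hφ.comp_continuous (by fun_prop) hmem⟩
  have H0 : ∀ a, H (0, a) = ((ContinuousMap.const K a₀ a : ℝ) : UnitAddCircle) := by
    intro a; simp [H, ha₀]
  have cov : IsCoveringMap ((↑) : ℝ → UnitAddCircle) := AddCircle.isCoveringMap_coe 1
  let L := cov.liftHomotopy H (ContinuousMap.const K a₀) H0
  have hL := cov.liftHomotopy_lifts H (ContinuousMap.const K a₀) H0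
  classical
  refine ⟨fun x => if h : x ∈ K then L (1, ⟨x, h⟩) else 0, ?_, ?_⟩
  · rw [continuousOn_iff_continuous_domRestrict]
    have : Continuous fun x : K => L (1, x) := by fun_prop
    convert this using 2 with x
    simp
  · intro x hx
    have := congrFun hL (1, ⟨x, hx⟩)
    simp only [hx, dite_true]
    simp only [Function.comp] at this
    rw [this]; simp [H]

/-- Two real lifts differ by a continuous integer-valued function. The uniqueness of all winding
numbers below rests on this. -/
theorem IsPreconnected.exists_int_sub_eq {E : Type*} [TopologicalSpace E] {K : Set E}
    (hK : IsPreconnected K) {f g : E → ℝ} (hf : ContinuousOn f K) (hg : ContinuousOn g K)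
    (h : ∀ x ∈ K, (f x : UnitAddCircle) = g x) : ∃ n : ℤ, ∀ x ∈ K, f x = g x + n := by
  rcases K.eq_empty_or_nonempty with rfl | ⟨x₀, hx₀⟩
  · exact ⟨0, by simp⟩
  have hd : DiscreteTopology (Set.range ((↑) : ℤ → ℝ)) :=
    Int.isClosedEmbedding_coe_real.isEmbedding.toHomeomorph.symm.isEmbedding.discreteTopology
  obtain ⟨n, hn⟩ := UnitAddCircle.coe_eq_coe_iff_int.1 (h x₀ hx₀)
  refine ⟨n, fun x hx => ?_⟩
  have := hK.constant_of_mapsTo (T := Set.range ((↑) : ℤ → ℝ)) ⟨hd⟩ (hf.sub hg) (fun y hy => by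
    obtain ⟨m, hm⟩ := UnitAddCircle.coe_eq_coe_iff_int.1 (h y hy)
    exact ⟨m, by simp [hm]⟩) hx hx₀
  simp only [Pi.sub_apply] at this
  linarith

/-! ### Angles and winding around a point of the plane. -/

/-- The argument of a complex number, measured in turns. -/
noncomputable def turn (z : ℂ) : UnitAddCircle := ((z.arg / (2 * Real.pi) : ℝ) : UnitAddCircle)

theorem Complex.eq_of_exp_eq_of_periodic {Z : Type*} {F : ℂ → Z}
    (hF : ∀ w, F (w + 2 * Real.pi * Complex.I) = F w) {w w' : ℂ}
    (h : Complex.exp w = Complex.exp w') : F w = F w' := by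
  obtain ⟨n, rfl⟩ := Complex.exp_eq_exp_iff_exists_int.1 h
  exact (show Function.Periodic F (2 * Real.pi * Complex.I) from hF).int_mul n w'

/-- Near `z` the logarithm may be replaced by `log (x / z) + log z`, which is continuous at `z` and
differs from `log x` by a multiple of the period. -/
theorem Complex.continuousAt_comp_log_of_periodic {Z : Type*} [TopologicalSpace Z] {F : ℂ → Z}
    (hc : Continuous F) (hF : ∀ w, F (w + 2 * Real.pi * Complex.I) = F w) {z : ℂ} (hz : z ≠ 0) :
    ContinuousAt (fun x => F (Complex.log x)) z := by
  have h1 : ContinuousAt (fun x : ℂ => F (Complex.log (x / z) + Complex.log z)) z := by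
    refine hc.continuousAt.comp ((ContinuousAt.clog (by fun_prop) ?_).add continuousAt_const)
    rw [div_self hz]; exact Complex.one_mem_slitPlane
  refine h1.congr ?_
  filter_upwards [isOpen_ne.mem_nhds hz] with x hx
  apply Complex.eq_of_exp_eq_of_periodic hF
  rw [Complex.exp_add, Complex.exp_log (div_ne_zero hx hz), Complex.exp_log hz,
    Complex.exp_log hx, div_mul_cancel₀ _ hz]

theorem periodic_im_turn (w : ℂ) :
    (((w + 2 * Real.pi * Complex.I).im / (2 * Real.pi) : ℝ) : UnitAddCircle) =
      ((w.im / (2 * Real.pi) : ℝ) : UnitAddCircle) := by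
  rw [UnitAddCircle.coe_eq_coe_iff_int]
  refine ⟨1, ?_⟩
  have := Real.pi_pos
  simp; field_simp

theorem turn_exp (w : ℂ) : turn (Complex.exp w) = ((w.im / (2 * Real.pi) : ℝ) : UnitAddCircle) := by
  have := Complex.eq_of_exp_eq_of_periodic
    (F := fun w : ℂ => ((w.im / (2 * Real.pi) : ℝ) : UnitAddCircle)) periodic_im_turn
    (Complex.exp_log (Complex.exp_ne_zero w))
  simp only [Complex.log_im] at this
  exact this

theorem continuousAt_turn {z : ℂ} (hz : z ≠ 0) : ContinuousAt turn z := by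
  have := Complex.continuousAt_comp_log_of_periodic
    (F := fun w : ℂ => ((w.im / (2 * Real.pi) : ℝ) : UnitAddCircle))
    ((AddCircle.continuous_mk' 1).comp (by fun_prop)) periodic_im_turn hz
  simp only [Complex.log_im] at this
  exact this

theorem turn_mul {z w : ℂ} (hz : z ≠ 0) (hw : w ≠ 0) : turn (z * w) = turn z + turn w := by
  rw [← Complex.exp_log hz, ← Complex.exp_log hw, ← Complex.exp_add, turn_exp, turn_exp, turn_exp,
    Complex.add_im, add_div, AddCircle.coe_add]

/-- The point of the unit circle with angle `2πx`. -/
noncomputable def circ (x : ℝ) : ℂ := Complex.exp ((2 * Real.pi * x : ℝ) * Complex.I)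

theorem turn_circ (x : ℝ) : turn (circ x) = x := by
  rw [circ, turn_exp]
  congr 1
  simp

theorem continuous_circ : Continuous circ := by unfold circ; fun_prop

theorem norm_circ (x : ℝ) : ‖circ x‖ = 1 := Complex.norm_exp_ofReal_mul_I _

theorem circ_add (x y : ℝ) : circ (x + y) = circ x * circ y := by
  unfold circ; rw [← Complex.exp_add]; congr 1; push_cast; ring

theorem circ_eq_circ_iff {x y : ℝ} : circ x = circ y ↔ ∃ n : ℤ, x = y + n := by
  rw [← UnitAddCircle.coe_eq_coe_iff_int]
  refine ⟨fun h => by rw [← turn_circ, h, turn_circ], fun h => ?_⟩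
  obtain ⟨n, rfl⟩ := UnitAddCircle.coe_eq_coe_iff_int.1 h
  unfold circ
  rw [Complex.exp_eq_exp_iff_exists_int]
  exact ⟨n, by push_cast; ring⟩

theorem circ_zero : circ 0 = 1 := by simp [circ]

theorem circ_one : circ 1 = 1 := by
  rw [← circ_zero, circ_eq_circ_iff]; exact ⟨1, by simp⟩

theorem exists_circ_eq {z : ℂ} (hz : ‖z‖ = 1) : ∃ x ∈ Set.Ico (0 : ℝ) 1, circ x = z := by
  have h1 : circ (z.arg / (2 * Real.pi)) = z := by
    have := Real.pi_pos
    unfold circ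
    have h2 : (2 * Real.pi * (z.arg / (2 * Real.pi))) = z.arg := by field_simp
    rw [h2]
    simpa [hz] using Complex.norm_mul_exp_arg_mul_I z
  refine ⟨Int.fract (z.arg / (2 * Real.pi)), ⟨Int.fract_nonneg _, Int.fract_lt_one _⟩, ?_⟩
  rw [← h1, circ_eq_circ_iff]
  refine ⟨-⌊z.arg / (2 * Real.pi)⌋, ?_⟩
  rw [h1]; unfold Int.fract; push_cast; ring

/-- Pull `ψ` back along `exp` and lift it to `G`. Translation by `2πi` changes `G` by a constant
integer `k`; subtracting `k` times the angle makes it periodic, so it descends through `log`. -/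
theorem exists_winding_of_continuousOn_compl_zero {ψ : ℂ → UnitAddCircle}
    (hψ : ContinuousOn ψ {0}ᶜ) :
    ∃ (k : ℤ) (g : ℂ → ℝ), ContinuousOn g {0}ᶜ ∧ ∀ z ≠ 0, ψ z = k • turn z + (g z : UnitAddCircle) := by
  obtain ⟨G, hG, hGψ⟩ := exists_real_lift_of_convex (φ := fun w => ψ (Complex.exp w)) convex_univ
    (hψ.comp (Complex.continuous_exp.continuousOn) (fun w _ => Complex.exp_ne_zero w))
  have hG' := continuousOn_univ.1 hG
  obtain ⟨k, hk⟩ := (isPreconnected_univ (α := ℂ)).exists_int_sub_eq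
    (f := fun w => G (w + 2 * Real.pi * Complex.I)) (g := G) (by fun_prop) hG (by
      intro w _
      rw [← hGψ _ trivial, ← hGψ _ trivial, Complex.exp_periodic])
  have hper : ∀ w : ℂ, G (w + 2 * Real.pi * Complex.I) -
      k * ((w + 2 * Real.pi * Complex.I).im / (2 * Real.pi)) = G w - k * (w.im / (2 * Real.pi)) := by
    intro w
    rw [hk w trivial]
    have := Real.pi_pos
    simp; field_simp; ring
  refine ⟨k, fun z => G (Complex.log z) - k * ((Complex.log z).im / (2 * Real.pi)), ?_, ?_⟩
  · intro z hz
    exact (Complex.continuousAt_comp_log_of_periodic (F := fun w : ℂ => G w - k * (w.im / (2 * Real.pi)))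
      (by fun_prop) hper hz).continuousWithinAt
  · intro z hz
    have h1 := hGψ (Complex.log z) trivial
    simp only [Complex.exp_log hz] at h1
    rw [h1, turn, ← AddCircle.coe_zsmul, ← AddCircle.coe_add]
    congr 1
    simp [Complex.log_im]

/-! ### Circle-valued maps on punctured disks. -/

/-- Retraction of the plane to the closed unit disk. -/
noncomputable def shrink (z : ℂ) : ℂ := ((max 1 ‖z‖)⁻¹ : ℝ) * z

theorem continuous_shrink : Continuous shrink := by
  unfold shrink
  refine Continuous.mul (Complex.continuous_ofReal.comp ?_) continuous_id
  exact Continuous.inv₀ (by fun_prop) fun z => by positivity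

theorem shrink_of_norm_le {z : ℂ} (hz : ‖z‖ ≤ 1) : shrink z = z := by
  simp [shrink, max_eq_left hz]

theorem norm_shrink (z : ℂ) : ‖shrink z‖ = (max 1 ‖z‖)⁻¹ * ‖z‖ := by
  rw [shrink, norm_mul, Complex.norm_real, Real.norm_of_nonneg (by positivity)]

theorem norm_shrink_le (z : ℂ) : ‖shrink z‖ ≤ 1 := by
  rw [norm_shrink, inv_mul_le_iff₀ (by positivity)]; simp

theorem shrink_ne_zero {z : ℂ} (hz : z ≠ 0) : shrink z ≠ 0 := by
  unfold shrink
  refine mul_ne_zero ?_ hz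
  rw [Complex.ofReal_ne_zero]; positivity

theorem shrink_eq_of_norm_lt {z : ℂ} (hz : ‖shrink z‖ < 1) : shrink z = z := by
  rcases le_or_gt ‖z‖ 1 with h | h
  · exact shrink_of_norm_le h
  · rw [norm_shrink, max_eq_right h.le, inv_mul_cancel₀ (by positivity)] at hz
    exact absurd hz (lt_irrefl _)

/-- The closed unit disk with finitely many punctures. -/
def puncturedDisk (S : Finset ℂ) : Set ℂ := Metric.closedBall 0 1 \ S

/-- `shrink` fixes the closed disk and sends all other points to the unit circle, so the punctured
disk is the image of the plane minus a finite set. -/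
theorem isPreconnected_puncturedDisk {S : Finset ℂ} (hS : ∀ s ∈ S, ‖s‖ < 1) :
    IsPreconnected (puncturedDisk S) := by
  have h1 : shrink '' (S : Set ℂ)ᶜ = puncturedDisk S := by
    ext z
    constructor
    · rintro ⟨w, hw, rfl⟩
      refine ⟨by simpa using norm_shrink_le w, fun h => hw ?_⟩
      rwa [shrink_eq_of_norm_lt (hS _ h)] at h
    · rintro ⟨hz, hz'⟩
      exact ⟨z, hz', shrink_of_norm_le (by simpa using hz)⟩
  rw [← h1]
  exact ((S.countable_toSet.isPathConnected_compl_of_one_lt_rank (by simp [Complex.rank_real_complex])).isConnected.isPreconnected).image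
    _ continuous_shrink.continuousOn

theorem continuousOn_turn_sub {s : ℂ} {A : Set ℂ} (h : s ∉ A) :
    ContinuousOn (fun z => turn (z - s)) A := fun z hz =>
  ((continuousAt_turn (sub_ne_zero.2 (ne_of_mem_of_not_mem hz h))).comp
    (f := fun z => z - s) (by fun_prop)).continuousWithinAt

theorem exists_ball_subset_puncturedDisk {S : Finset ℂ} {s : ℂ} (hs : ‖s‖ < 1) (hsS : s ∉ S) :
    ∃ r > 0, Metric.closedBall s r ⊆ puncturedDisk S := by
  have : Metric.ball 0 1 \ (S : Set ℂ) ∈ nhds s :=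
    (Metric.isOpen_ball.sdiff S.finite_toSet.isClosed).mem_nhds ⟨by simpa using hs, hsS⟩
  obtain ⟨r, hr, h⟩ := Metric.nhds_basis_closedBall.mem_iff.1 this
  exact ⟨r, hr, h.trans (Set.sdiff_subset_sdiff_left Metric.ball_subset_closedBall)⟩

/-- Circle-valued maps on a punctured disk. -/
theorem exists_winding_of_puncturedDisk (S : Finset ℂ) (hS : ∀ s ∈ S, ‖s‖ < 1)
    {φ : ℂ → UnitAddCircle} (hφ : ContinuousOn φ (puncturedDisk S)) :
    ∃ (k : ℂ → ℤ) (g : ℂ → ℝ), ContinuousOn g (puncturedDisk S) ∧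
      ∀ z ∈ puncturedDisk S, φ z = ∑ s ∈ S, k s • turn (z - s) + (g z : UnitAddCircle) := by
  classical
  induction S using Finset.induction_on generalizing φ with
  | empty =>
    obtain ⟨g, hg, h⟩ := exists_real_lift_of_convex (φ := φ) (K := puncturedDisk ∅)
      (by simpa [puncturedDisk] using convex_closedBall (0 : ℂ) 1) hφ
    exact ⟨0, g, hg, by simpa using h⟩
  | insert s S hsS ih =>
    have hs : ‖s‖ < 1 := hS s (by simp)
    obtain ⟨r, hr, hrS⟩ := exists_ball_subset_puncturedDisk hs hsS
    have hr' : (r : ℂ) ≠ 0 := by exact_mod_cast hr.ne'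
    -- The ball about `s` contains no other puncture. Precomposing with `shrink` extends the
    -- rescaled map from the unit disk to the whole punctured plane.
    obtain ⟨k₀, g₀, hg₀, h₀⟩ := exists_winding_of_continuousOn_compl_zero
      (ψ := fun z => φ (s + r * shrink z)) (by
        refine hφ.comp (by have := continuous_shrink; fun_prop) fun z hz => ?_
        have h1 : s + r * shrink z ∈ puncturedDisk S := hrS (by
          rw [mem_closedBall_iff_norm, add_sub_cancel_left, norm_mul, Complex.norm_real,
            Real.norm_of_nonneg hr.le]
          exact mul_le_of_le_one_right hr.le (norm_shrink_le z))
        refine ⟨h1.1, fun h => ?_⟩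
        rcases Finset.mem_insert.1 (Finset.mem_coe.1 h) with h | h
        · have : (r : ℂ) * shrink z = 0 := by simpa using h
          exact mul_ne_zero hr' (shrink_ne_zero hz) this
        · exact h1.2 h)
    have hsub : puncturedDisk (insert s S) = puncturedDisk S \ {s} := by
      ext z; simp [puncturedDisk, and_assoc, not_or, and_comm]
    have hg₁ : ContinuousOn (fun z => g₀ ((z - s) / r)) {s}ᶜ :=
      hg₀.comp (by fun_prop) fun z hz => div_ne_zero (sub_ne_zero.2 hz) hr'
    -- Removing the winding and real part found near `s` leaves zero on the punctured ball, so the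
    -- value 0 fills the puncture continuously and the induction hypothesis applies.
    let φ' : ℂ → UnitAddCircle := fun z =>
      if z = s then 0 else φ z - k₀ • turn ((z - s) / r) - (g₀ ((z - s) / r) : UnitAddCircle)
    have hturn : ContinuousOn (fun z => turn ((z - s) / r)) {s}ᶜ := fun z hz =>
      ((continuousAt_turn (div_ne_zero (sub_ne_zero.2 hz) hr')).comp
        (f := fun z => (z - s) / r) (by fun_prop)).continuousWithinAt
    have hφ' : ContinuousOn φ' (puncturedDisk S) := by
      intro z hz
      by_cases hzs : z = s
      · subst hzs
        refine ContinuousAt.continuousWithinAt (ContinuousAt.congr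
          (continuousAt_const (y := (0 : UnitAddCircle))) ?_)
        filter_upwards [Metric.closedBall_mem_nhds z hr] with w hw
        by_cases hwz : w = z
        · simp [φ', hwz]
        · have h1 : (w - z) / r ≠ 0 := div_ne_zero (sub_ne_zero.2 hwz) hr'
          have h2 := h₀ _ h1
          rw [shrink_of_norm_le, mul_div_cancel₀ _ hr', add_sub_cancel] at h2
          · simp [φ', hwz, h2]
          · rw [norm_div, Complex.norm_real, Real.norm_of_nonneg hr.le]
            exact div_le_one_of_le₀ (mem_closedBall_iff_norm.1 hw) hr.le
      · have h1 : ContinuousOn (fun z => φ z - k₀ • turn ((z - s) / r) -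
            (g₀ ((z - s) / r) : UnitAddCircle)) (puncturedDisk (insert s S)) := by
          refine ContinuousOn.sub (hφ.sub ?_) ?_
          · exact ContinuousOn.zsmul (hturn.mono (by rw [hsub]; exact fun x hx => hx.2)) k₀
          · exact (AddCircle.continuous_mk' 1).comp_continuousOn
              (hg₁.mono (by rw [hsub]; exact fun x hx => hx.2))
        have h2 := h1 z (by rw [hsub]; exact ⟨hz, hzs⟩)
        have h3 : ContinuousWithinAt φ' (puncturedDisk (insert s S)) z :=
          h2.congr (fun y hy => by
            rw [hsub] at hy
            exact if_neg hy.2) (if_neg hzs)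
        rw [hsub] at h3
        refine h3.mono_of_mem_nhdsWithin ?_
        exact Filter.inter_mem self_mem_nhdsWithin
          (mem_nhdsWithin_of_mem_nhds (isOpen_ne.mem_nhds hzs))
    obtain ⟨k, g, hg, h⟩ := ih (fun x hx => hS x (by simp [hx])) hφ'
    refine ⟨fun x => if x = s then k₀ else k x,
      fun z => g z + g₀ ((z - s) / r), ?_, fun z hz => ?_⟩
    · refine ContinuousOn.add (hg.mono ?_) (hg₁.mono ?_)
      · rw [hsub]; exact Set.sdiff_subset
      · rw [hsub]; exact fun x hx => hx.2
    · rw [hsub] at hz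
      have hzs : z ≠ s := hz.2
      have h1 := h z hz.1
      simp only [φ', if_neg hzs] at h1
      have h2 : turn (z - s) = turn ((z - s) / r) := by
        have h3 : z - s = (r : ℂ) * ((z - s) / r) := by field_simp
        conv_lhs => rw [h3, turn_mul hr' (div_ne_zero (sub_ne_zero.2 hzs) hr')]
        simp [turn, Complex.arg_ofReal_of_nonneg hr.le]
      simp only []
      rw [Finset.sum_insert hsS, if_pos rfl, h2, Finset.sum_congr rfl
        (g := fun x => k x • turn (z - x)) (fun x hx => by
          rw [if_neg (ne_of_mem_of_not_mem hx hsS)]), AddCircle.coe_add, ← add_assoc, add_assoc _ _ (g z : UnitAddCircle), ← h1]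
      abel

/-- On a small circle around `s` the terms of the other punctures lift to the reals. So `k s * x`
is, up to a constant, a 1-periodic function of `x`; compare `x = 0` with `x = 1`. -/
theorem winding_unique {S : Finset ℂ} (hS : ∀ s ∈ S, ‖s‖ < 1) {k : ℂ → ℤ} {g : ℂ → ℝ}
    (hg : ContinuousOn g (puncturedDisk S))
    (h : ∀ z ∈ puncturedDisk S, ∑ s ∈ S, k s • turn (z - s) = (g z : UnitAddCircle)) :
    ∀ s ∈ S, k s = 0 := by
  classical
  intro s hs
  obtain ⟨r, hr, hrS⟩ := exists_ball_subset_puncturedDisk (hS s hs) (Finset.notMem_erase s S)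
  have hr' : (r : ℂ) ≠ 0 := by exact_mod_cast hr.ne'
  obtain ⟨L, hL, hL'⟩ := exists_real_lift_of_convex (convex_closedBall s r)
    (φ := fun z => ∑ x ∈ S.erase s, k x • turn (z - x)) (by
      refine continuousOn_finsetSum _ fun x hx => ContinuousOn.zsmul (continuousOn_turn_sub ?_) _
      exact fun h => (hrS h).2 hx)
  have hc : Continuous fun x : ℝ => s + r * circ x := by have := continuous_circ; fun_prop
  have hcm : ∀ x : ℝ, s + r * circ x ∈ Metric.closedBall s r := fun x => by
    simp [norm_circ, abs_of_pos hr]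
  have hne : ∀ x : ℝ, (r : ℂ) * circ x ≠ 0 := fun x =>
    mul_ne_zero hr' (by rw [← norm_ne_zero_iff, norm_circ]; norm_num)
  have hcp : ∀ x : ℝ, s + r * circ x ∈ puncturedDisk S := fun x => by
    refine ⟨(hrS (hcm x)).1, fun h => (hrS (hcm x)).2 ?_⟩
    simp only [Finset.coe_erase]
    exact ⟨h, fun e => hne x (by simpa using e)⟩
  obtain ⟨n, hn⟩ := (isPreconnected_univ (α := ℝ)).exists_int_sub_eq
    (f := fun x => k s * x) (g := fun x => g (s + r * circ x) - L (s + r * circ x))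
    (by fun_prop)
    ((hg.comp_continuous hc hcp).sub (hL.comp_continuous hc hcm)).continuousOn (by
      intro x _
      rw [AddCircle.coe_sub, ← h _ (hcp x), ← hL' _ (hcm x), ← Finset.add_sum_erase S _ hs,
        add_sub_cancel_right, add_sub_cancel_left, turn_mul hr'
          (by rw [← norm_ne_zero_iff, norm_circ]; norm_num), turn_circ]
      simp only [turn, Complex.arg_ofReal_of_nonneg hr.le, zero_div, AddCircle.coe_zero, zero_add]
      rw [← AddCircle.coe_zsmul]; simp)
  have h0 := hn 0 trivial
  have h1 := hn 1 trivial
  rw [circ_zero] at h0; rw [circ_one] at h1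
  have : (k s : ℝ) = 0 := by simp at h0 h1; linarith
  exact_mod_cast this

/-! ### The boundary circle and its division into sides. -/

/-- The angle of `circ x - s`, in turns, followed continuously. -/
noncomputable def circAngle (s : ℂ) (x : ℝ) : ℝ := x + (1 - s * circ (-x)).arg / (2 * Real.pi)

/-- For `‖s‖ < 1` the factor `1 - s * circ (-x)` of `circ x - s` has positive real part, and `arg`
is continuous there. -/
theorem continuous_circAngle {s : ℂ} (hs : ‖s‖ < 1) : Continuous (circAngle s) := by
  unfold circAngle
  refine continuous_id.add (Continuous.div_const ?_ _)
  refine continuous_iff_continuousAt.2 fun x => ?_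
  refine (Complex.continuousAt_arg ?_).comp (f := fun x : ℝ => 1 - s * circ (-x))
    (by have := continuous_circ; fun_prop)
  left
  have h1 : ‖s * circ (-x)‖ < 1 := by rwa [norm_mul, norm_circ, mul_one]
  have := (abs_le.1 (Complex.abs_re_le_norm (s * circ (-x)))).2
  simp only [Complex.sub_re, Complex.one_re]
  linarith

theorem turn_circ_sub {s : ℂ} (hs : ‖s‖ < 1) (x : ℝ) :
    turn (circ x - s) = (circAngle s x : UnitAddCircle) := by
  have h0 : circ x * circ (-x) = 1 := by rw [← circ_add, add_neg_cancel, circ_zero]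
  have h1 : circ x - s = circ x * (1 - s * circ (-x)) := by linear_combination s * h0
  have hc : circ x ≠ 0 := by rw [← norm_ne_zero_iff, norm_circ]; norm_num
  have h2 : (1 - s * circ (-x)) ≠ 0 := fun h => by
    rw [h, mul_zero, sub_eq_zero] at h1
    rw [← h1, norm_circ] at hs; exact lt_irrefl _ hs
  rw [h1, turn_mul hc h2, turn_circ, circAngle, AddCircle.coe_add]; rfl

theorem circAngle_one (s : ℂ) : circAngle s 1 = circAngle s 0 + 1 := by
  have : circ (-1) = circ (-0) := circ_eq_circ_iff.2 ⟨-1, by simp⟩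
  simp only [circAngle, this]; ring

/-- The integer `j - j' - n * N` equals `t' - t`, so it is -1, 0 or 1: either the points are the
same, or they are the common end of cyclically consecutive sides. -/
theorem circ_div_eq_circ_div {N : ℕ} [NeZero N] {j j' : Fin N} {t t' : unitInterval}
    (h : circ (((j : ℕ) + (t : ℝ)) / N) = circ (((j' : ℕ) + (t' : ℝ)) / N)) :
    (j = j' ∧ t = t') ∨ (t = 1 ∧ t' = 0 ∧ j' = j + 1) ∨ (t = 0 ∧ t' = 1 ∧ j = j' + 1) := by
  obtain ⟨n, hn⟩ := circ_eq_circ_iff.1 h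
  have hN : (0 : ℝ) < N := by exact_mod_cast NeZero.pos N
  have h1 : (((j : ℕ) - (j' : ℕ) - n * N : ℤ) : ℝ) = t' - t := by
    push_cast; field_simp at hn; linarith
  have ht := t.2; have ht' := t'.2
  have h2 : ((j : ℕ) - (j' : ℕ) - n * N : ℤ) ≤ 1 := by
    have : (((j : ℕ) - (j' : ℕ) - n * N : ℤ) : ℝ) ≤ (1 : ℤ) := by
      rw [h1]; push_cast; linarith [ht.1, ht'.2]
    exact_mod_cast this
  have h3 : -1 ≤ ((j : ℕ) - (j' : ℕ) - n * N : ℤ) := by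
    have : ((-1 : ℤ) : ℝ) ≤ (((j : ℕ) - (j' : ℕ) - n * N : ℤ) : ℝ) := by
      rw [h1]; push_cast; linarith [ht.2, ht'.1]
    exact_mod_cast this
  have key : ∀ (i i' : Fin N) (m : ℤ), ((i : ℕ) : ℤ) = (i' : ℕ) + 1 + m * N → i = i' + 1 := by
    intro i i' m him
    apply Fin.ext
    have e1 : ((i : ℕ) : ℤ) = (((i' : ℕ) + 1 : ℕ) : ℤ) % (N : ℤ) := by
      rw [← Int.emod_eq_of_lt (by positivity) (by exact_mod_cast i.2 : ((i : ℕ) : ℤ) < N), him]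
      simp
    have e2 : (i : ℕ) = ((i' : ℕ) + 1) % N := by exact_mod_cast e1
    rw [e2, Fin.val_add, Fin.val_one', Nat.add_mod_mod]
  generalize hm : ((j : ℕ) - (j' : ℕ) - n * N : ℤ) = m at h1 h2 h3
  interval_cases m
  · right; left
    push_cast at h1
    refine ⟨Subtype.ext ?_, Subtype.ext ?_, key j' j (-n) (by linarith)⟩
    · simp only [Set.Icc.coe_one]; linarith [ht.2, ht'.1]
    · simp only [Set.Icc.coe_zero]; linarith [ht.2, ht'.1]
  · left
    have hj := j.2; have hj' := j'.2
    have hn0 : n = 0 := by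
      have a1 : n * N < 1 * N := by omega
      have a2 : (-1) * (N : ℤ) < n * N := by omega
      have := lt_of_mul_lt_mul_right a1 (by positivity)
      have := lt_of_mul_lt_mul_right a2 (by positivity)
      omega
    subst hn0
    refine ⟨Fin.ext (by simp at hm; omega), Subtype.ext (by push_cast at h1; linarith)⟩
  · right; right
    push_cast at h1
    refine ⟨Subtype.ext ?_, Subtype.ext ?_, key j j' n (by linarith)⟩
    · simp only [Set.Icc.coe_zero]; linarith [ht.1, ht'.2]
    · simp only [Set.Icc.coe_one]; linarith [ht.1, ht'.2]

theorem circ_mem_sphere (x : ℝ) : circ x ∈ Metric.sphere (0 : ℂ) 1 := by simp [norm_circ]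

theorem exists_side_eq (N : ℕ) [NeZero N] {z : ℂ} (hz : ‖z‖ = 1) :
    ∃ (j : Fin N) (t : unitInterval), circ (((j : ℕ) + (t : ℝ)) / N) = z := by
  obtain ⟨x, ⟨hx0, hx1⟩, rfl⟩ := exists_circ_eq hz
  have hN : (0 : ℝ) < N := by exact_mod_cast NeZero.pos N
  have h0 : 0 ≤ N * x := by positivity
  refine ⟨⟨⌊N * x⌋₊, (Nat.floor_lt h0).2 (by nlinarith)⟩,
    ⟨N * x - ⌊N * x⌋₊, sub_nonneg.2 (Nat.floor_le h0), ?_⟩, ?_⟩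
  · linarith [Nat.lt_floor_add_one (N * x)]
  · congr 1; simp; field_simp

/-- Compatible maps on the sides of a polygon glue to a map on the circle. -/
theorem exists_circle_map {Z : Type*} [TopologicalSpace Z] {N : ℕ} [NeZero N]
    (β : Fin N → unitInterval → Z) (hβ : ∀ j, Continuous (β j))
    (h : ∀ j, β j 1 = β (j + 1) 0) :
    ∃ c : C(Metric.sphere (0 : ℂ) 1, Z),
      ∀ (j : Fin N) (t : unitInterval), c ⟨circ (((j : ℕ) + (t : ℝ)) / N), circ_mem_sphere _⟩ = β j t := by
  let q : Fin N × unitInterval → Metric.sphere (0 : ℂ) 1 :=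
    fun p => ⟨circ (((p.1 : ℕ) + (p.2 : ℝ)) / N), circ_mem_sphere _⟩
  have hq : Continuous q := by
    refine Continuous.subtype_mk (continuous_circ.comp ?_) _
    refine continuous_prod_of_discrete_left.2 fun j => ?_
    fun_prop
  have hqs : Function.Surjective q := by
    rintro ⟨z, hz⟩
    obtain ⟨j, t, e⟩ := exists_side_eq N (z := z) (by simpa using hz)
    exact ⟨(j, t), Subtype.ext e⟩
  have hqq : Topology.IsQuotientMap (⟨q, hq⟩ : C(Fin N × unitInterval, Metric.sphere (0 : ℂ) 1)) :=
    hq.isClosedMap.isQuotientMap hq hqs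
  have hβc : Continuous fun p : Fin N × unitInterval => β p.1 p.2 :=
    continuous_prod_of_discrete_left.2 hβ
  have hf : Function.FactorsThrough (⟨_, hβc⟩ : C(Fin N × unitInterval, Z))
      (⟨q, hq⟩ : C(Fin N × unitInterval, Metric.sphere (0 : ℂ) 1)) := by
    rintro ⟨j, t⟩ ⟨j', t'⟩ e
    rcases circ_div_eq_circ_div (congrArg Subtype.val e) with
      ⟨rfl, rfl⟩ | ⟨rfl, rfl, rfl⟩ | ⟨rfl, rfl, rfl⟩
    · rfl
    · exact h j
    · exact (h j').symm
  exact ⟨hqq.lift _ hf, fun j t => DFunLike.congr_fun (hqq.lift_comp _ hf) (j, t)⟩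

/-- By Tietze, real boundary data extend over a polygon as soon as they close up around it. -/
theorem exists_real_fill {N : ℕ} [NeZero N]
    (β : Fin N → unitInterval → ℝ) (hβ : ∀ j, Continuous (β j))
    (h : ∀ j, β j 1 = β (j + 1) 0) :
    ∃ g : ℂ → ℝ, Continuous g ∧
      ∀ (j : Fin N) (t : unitInterval), g (circ (((j : ℕ) + (t : ℝ)) / N)) = β j t := by
  obtain ⟨c, hc⟩ := exists_circle_map β hβ h
  obtain ⟨g, hg⟩ := c.exists_restrict_eq (Metric.isClosed_sphere)
  exact ⟨g, g.continuous, fun j t => by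
    rw [← hc]; exact DFunLike.congr_fun hg ⟨_, circ_mem_sphere _⟩⟩

/-! ### The realization, its punctures, and functions on it. -/

namespace PolygonalPresentation

variable (P : PolygonalPresentation)

/-- The point at time `t` on a side, as a complex number. -/
noncomputable def sideCoord (e : P.Side) (t : unitInterval) : ℂ := (P.sidePoint e t).2

theorem sideCoord_eq (e : P.Side) (t : unitInterval) : P.sideCoord e t =
    circ (((e.2 : ℕ) + (if P.orientation e then (t : ℝ) else 1 - (t : ℝ))) / (P.sides e.1 : ℝ)) :=
  rfl

theorem norm_sideCoord (e : P.Side) (t : unitInterval) : ‖P.sideCoord e t‖ = 1 := norm_circ _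

theorem continuous_sideCoord (e : P.Side) : Continuous (P.sideCoord e) := by
  simp only [funext (P.sideCoord_eq e)]
  refine continuous_circ.comp ?_
  split_ifs <;> fun_prop

/-- The quotient map from the disjoint union of the polygons. -/
def toRealization (x : Σ _ : Fin P.numFaces, Disk) : P.Realization := Quot.mk _ x

theorem isQuotientMap_toRealization : Topology.IsQuotientMap P.toRealization :=
  isQuotientMap_quot_mk

/-- The image in the realization of a point of a polygon. -/
def proj (f : Fin P.numFaces) (z : Disk) : P.Realization := P.toRealization ⟨f, z⟩

theorem continuous_proj (f : Fin P.numFaces) : Continuous (P.proj f) :=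
  P.isQuotientMap_toRealization.continuous.comp continuous_sigmaMk

theorem exists_proj_eq (x : P.Realization) : ∃ f z, P.proj f z = x := by
  induction x using Quot.inductionOn with
  | h p => exact ⟨p.1, p.2, rfl⟩

theorem proj_side (e : P.Side) (t : unitInterval) :
    P.proj e.1 (P.sidePoint e t).2 = P.proj (P.pairing e).1 (P.sidePoint (P.pairing e) t).2 :=
  Quot.sound ⟨e, t, rfl, rfl⟩

/-- Being equal to the given interior point is false at all side points, so this predicate respects
the gluing and descends to the quotient. -/
theorem eq_of_proj_eq_of_norm_lt {f f' : Fin P.numFaces} {w z : Disk} (hz : ‖(z : ℂ)‖ < 1)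
    (h : P.proj f w = P.proj f' z) : (⟨f, w⟩ : Σ _ : Fin P.numFaces, Disk) = ⟨f', z⟩ := by
  let F : P.Realization → Prop := Quot.lift (fun x => x = ⟨f', z⟩) (by
    rintro _ _ ⟨e, t, rfl, rfl⟩
    have key : ∀ e, P.sidePoint e t ≠ ⟨f', z⟩ := fun e h => by
      have h1 : ‖((P.sidePoint e t).2 : ℂ)‖ = 1 := P.norm_sideCoord e t
      rw [h] at h1; exact hz.ne h1
    simp [key])
  have h1 : F (P.proj f' z) := rfl
  rw [← h] at h1; exact h1

/-- The realization with finitely many points removed. -/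
def punctured (S : Fin P.numFaces → Finset ℂ) : Set P.Realization :=
  {y | ∀ f (z : Disk), (z : ℂ) ∈ S f → y ≠ P.proj f z}

variable {P} {S : Fin P.numFaces → Finset ℂ}

theorem proj_mem_punctured (hS : ∀ f, ∀ s ∈ S f, ‖s‖ < 1) {f : Fin P.numFaces} {z : Disk} :
    P.proj f z ∈ P.punctured S ↔ (z : ℂ) ∉ S f := by
  refine ⟨fun h hz => h f z hz rfl, fun h f' z' hz' e => ?_⟩
  have := P.eq_of_proj_eq_of_norm_lt (hS _ _ hz') e
  simp only [Sigma.mk.injEq, heq_eq_eq] at this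
  obtain ⟨rfl, rfl⟩ := this
  exact h hz'

theorem isOpen_punctured (hS : ∀ f, ∀ s ∈ S f, ‖s‖ < 1) : IsOpen (P.punctured S) := by
  rw [← P.isQuotientMap_toRealization.isOpen_preimage, isOpen_sigma_iff]
  intro f
  have : (Sigma.mk f ⁻¹' (P.toRealization ⁻¹' P.punctured S)) =
      (fun z : Disk => (z : ℂ)) ⁻¹' ((S f : Set ℂ)ᶜ) := by
    ext z
    exact proj_mem_punctured hS
  rw [this]
  exact ((S f).finite_toSet.isClosed.isOpen_compl).preimage continuous_subtype_val

/-- The retraction of the plane to the closed unit disk. -/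
noncomputable def toDisk (z : ℂ) : Disk := ⟨shrink z, by simpa using norm_shrink_le z⟩

theorem toDisk_coe (z : Disk) : toDisk z = z :=
  Subtype.ext (shrink_of_norm_le (mem_closedBall_zero_iff.1 z.2))

theorem coe_toDisk {z : ℂ} (hz : z ∈ Metric.closedBall (0 : ℂ) 1) : (toDisk z : ℂ) = z :=
  shrink_of_norm_le (by simpa using hz)

theorem proj_toDisk_mem (hS : ∀ f, ∀ s ∈ S f, ‖s‖ < 1) {f : Fin P.numFaces} {z : ℂ}
    (hz : z ∈ puncturedDisk (S f)) : P.proj f (toDisk z) ∈ P.punctured S := by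
  rw [proj_mem_punctured hS, coe_toDisk hz.1]
  exact hz.2

open Classical in
/-- A function on the punctured realization, as a function on a polygon. -/
noncomputable def pull {Z : Type*} [Zero Z] (G : P.punctured S → Z) (f : Fin P.numFaces) (z : ℂ) :
    Z :=
  if h : P.proj f (toDisk z) ∈ P.punctured S then G ⟨_, h⟩ else 0

variable {Z : Type*}

theorem pull_of_mem [Zero Z] (hS : ∀ f, ∀ s ∈ S f, ‖s‖ < 1) (G : P.punctured S → Z)
    {f : Fin P.numFaces} {z : ℂ} (hz : z ∈ puncturedDisk (S f)) :
    pull G f z = G ⟨P.proj f (toDisk z), proj_toDisk_mem hS hz⟩ :=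
  dif_pos _

theorem pull_add [AddMonoid Z] (G G' : P.punctured S → Z) (f : Fin P.numFaces) (z : ℂ) :
    pull (fun y => G y + G' y) f z = pull G f z + pull G' f z := by
  unfold pull; split_ifs <;> simp

theorem pull_comp {Z' : Type*} [Zero Z] [Zero Z'] (u : Z → Z') (hu : u 0 = 0)
    (G : P.punctured S → Z) (f : Fin P.numFaces) (z : ℂ) :
    pull (fun y => u (G y)) f z = u (pull G f z) := by
  unfold pull; split_ifs <;> simp [hu]

theorem continuousOn_pull [Zero Z] [TopologicalSpace Z] (hS : ∀ f, ∀ s ∈ S f, ‖s‖ < 1)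
    {G : P.punctured S → Z} (hG : Continuous G) (f : Fin P.numFaces) :
    ContinuousOn (pull G f) (puncturedDisk (S f)) := by
  rw [continuousOn_iff_continuous_domRestrict]
  have : Continuous fun z : puncturedDisk (S f) =>
      G ⟨P.proj f (toDisk z), proj_toDisk_mem hS z.2⟩ := by
    refine hG.comp (Continuous.subtype_mk ((P.continuous_proj f).comp ?_) _)
    exact Continuous.subtype_mk (continuous_shrink.comp continuous_subtype_val) _
  convert this using 2 with z
  exact pull_of_mem hS G z.2

theorem pull_side [Zero Z] (G : P.punctured S → Z) (e : P.Side) (t : unitInterval) :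
    pull G e.1 (P.sideCoord e t) = pull G (P.pairing e).1 (P.sideCoord (P.pairing e) t) := by
  classical
  have : P.proj e.1 (toDisk (P.sideCoord e t)) =
      P.proj (P.pairing e).1 (toDisk (P.sideCoord (P.pairing e) t)) := by
    unfold sideCoord
    rw [toDisk_coe, toDisk_coe, proj_side]
  have key : ∀ {x y : P.Realization}, x = y →
      (if h : x ∈ P.punctured S then G ⟨x, h⟩ else 0) =
        (if h : y ∈ P.punctured S then G ⟨y, h⟩ else 0) := by
    rintro x _ rfl; rfl
  exact key this

theorem eq_of_pull_eq [Zero Z] (hS : ∀ f, ∀ s ∈ S f, ‖s‖ < 1) {G G' : P.punctured S → Z}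
    (h : ∀ f, ∀ z ∈ puncturedDisk (S f), pull G f z = pull G' f z) : G = G' := by
  funext ⟨y, hy⟩
  obtain ⟨f, z, rfl⟩ := P.exists_proj_eq y
  have hz : (z : ℂ) ∈ puncturedDisk (S f) := ⟨z.2, (proj_mem_punctured hS).1 hy⟩
  have := h f z hz
  rw [pull_of_mem hS _ hz, pull_of_mem hS _ hz] at this
  simpa only [toDisk_coe] using this

/-- Compatible functions on the polygons glue. -/
theorem exists_pull_eq [Zero Z] [TopologicalSpace Z] (hS : ∀ f, ∀ s ∈ S f, ‖s‖ < 1)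
    (g : Fin P.numFaces → ℂ → Z) (hg : ∀ f, ContinuousOn (g f) (puncturedDisk (S f)))
    (h : ∀ (e : P.Side) (t : unitInterval),
      g e.1 (P.sideCoord e t) = g (P.pairing e).1 (P.sideCoord (P.pairing e) t)) :
    ∃ G : C(P.punctured S, Z), ∀ f, ∀ z ∈ puncturedDisk (S f), pull G f z = g f z := by
  let g' : (Σ _ : Fin P.numFaces, Disk) → Z := fun x => g x.1 x.2
  let G₀ : P.Realization → Z := Quot.lift g' (by
    rintro _ _ ⟨e, t, rfl, rfl⟩
    exact h e t)
  -- Over an open set a quotient map is still a quotient map, so continuity can be checked on the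
  -- polygons.
  have hq' := P.isQuotientMap_toRealization.restrictPreimage_isOpen (isOpen_punctured hS)
  have hc : Continuous fun y : P.punctured S => G₀ y := by
    rw [hq'.continuous_iff]
    have : ContinuousOn g' (P.toRealization ⁻¹'
        P.punctured S) := by
      rintro ⟨f, z⟩ hz
      have hz' : (z : ℂ) ∉ S f := (proj_mem_punctured hS).1 hz
      refine ContinuousAt.continuousWithinAt ?_
      refine Topology.IsOpenEmbedding.continuousAt_iff (f := Sigma.mk f)
        Topology.IsOpenEmbedding.sigmaMk |>.1 ?_
      have h1 : ContinuousOn (fun z : Disk => g f z) {z | (z : ℂ) ∉ S f} :=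
        (hg f).comp continuous_subtype_val.continuousOn fun w hw => ⟨w.2, hw⟩
      exact h1.continuousAt (((S f).finite_toSet.isClosed.isOpen_compl.preimage
        continuous_subtype_val).mem_nhds hz')
    exact continuousOn_iff_continuous_domRestrict.1 this
  refine ⟨⟨_, hc⟩, fun f z hz => ?_⟩
  rw [pull_of_mem hS _ hz]
  show g f (toDisk z) = g f z
  rw [coe_toDisk hz.1]

theorem sideCoord_mem (hS : ∀ f, ∀ s ∈ S f, ‖s‖ < 1) (e : P.Side) (t : unitInterval) :
    P.sideCoord e t ∈ puncturedDisk (S e.1) :=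
  ⟨by simp [norm_sideCoord], fun h => (hS _ _ h).ne (P.norm_sideCoord e t)⟩

end PolygonalPresentation

/-! ### Cellular cochains and winding data. -/

theorem circ_succ_div {N : ℕ} [NeZero N] (j : Fin N) :
    circ (((j : ℕ) + 1) / N) = circ (((j + 1 : Fin N) : ℕ) / N) := by
  have hN : (N : ℝ) ≠ 0 := NeZero.ne _
  rw [circ_eq_circ_iff]
  rcases Nat.lt_or_ge ((j : ℕ) + 1) N with h | h
  · refine ⟨0, ?_⟩
    have : ((j + 1 : Fin N) : ℕ) = j + 1 := by
      rw [Fin.val_add, Fin.val_one', Nat.add_mod_mod, Nat.mod_eq_of_lt h]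
    rw [this]; simp
  · have h' : (j : ℕ) + 1 = N := le_antisymm j.2 h
    refine ⟨1, ?_⟩
    have : ((j + 1 : Fin N) : ℕ) = 0 := by
      rw [Fin.val_add, Fin.val_one', Nat.add_mod_mod, h', Nat.mod_self]
    have h'' : ((j : ℕ) : ℝ) + 1 = N := by exact_mod_cast h'
    rw [this, h'']; simp [hN]

theorem Fin.eq_zero_apply_of_succ {N : ℕ} [NeZero N] {α : Type*} {h : Fin N → α}
    (hh : ∀ j, h (j + 1) = h j) (j : Fin N) : h j = h 0 := by
  obtain ⟨n, hn⟩ := j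
  induction n with
  | zero => rfl
  | succ n ih =>
    rw [← ih (Nat.lt_of_succ_lt hn), ← hh ⟨n, _⟩]
    congr 1
    apply Fin.ext
    rw [Fin.val_add, Fin.val_one', Nat.add_mod_mod, Nat.mod_eq_of_lt hn]

namespace PolygonalPresentation

section
variable (P : PolygonalPresentation)

/-- A corner, as a complex number. -/
noncomputable def cornerCoord (c : P.Corner) : ℂ := circ (((c.2 : ℕ) : ℝ) / (P.sides c.1 : ℝ))

/-- The vertex given by a corner. -/
def vertexOf (c : P.Corner) : P.Vertex := Quot.mk _ c

/-- The edge given by a side. -/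
def edgeOf (e : P.Side) : P.Edge := Quot.mk _ e

theorem edgeOf_pairing (e : P.Side) : P.edgeOf (P.pairing e) = P.edgeOf e :=
  (Quot.sound rfl : P.edgeOf e = P.edgeOf (P.pairing e)).symm

theorem vertexOf_source (e : P.Side) :
    P.vertexOf (P.source e) = P.vertexOf (P.source (P.pairing e)) :=
  Quot.sound ⟨e, Or.inl ⟨rfl, rfl⟩⟩

theorem vertexOf_target (e : P.Side) :
    P.vertexOf (P.target e) = P.vertexOf (P.target (P.pairing e)) :=
  Quot.sound ⟨e, Or.inr ⟨rfl, rfl⟩⟩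

instance : Finite P.Vertex := inferInstanceAs (Finite (Quot _))

instance : Finite P.Edge := inferInstanceAs (Finite (Quot _))

theorem cornerCoord_eq_sideCoord (c : P.Corner) :
    P.cornerCoord c = P.sideCoord c (if P.orientation c then 0 else 1) := by
  rw [sideCoord_eq, cornerCoord]; split_ifs <;> simp

/-- The polygon of `P.source e` is that of `e` only after a case split; stating the identity through
an arbitrary `g` avoids transport along this equality. -/
theorem apply_source {Z : Type*} (g : Fin P.numFaces → ℂ → Z) (e : P.Side) :
    g (P.source e).1 (P.cornerCoord (P.source e)) = g e.1 (P.sideCoord e 0) := by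
  rw [sideCoord_eq, source]
  split_ifs with h
  · simp [cornerCoord]
  · simp [cornerCoord, circ_succ_div]

theorem apply_target {Z : Type*} (g : Fin P.numFaces → ℂ → Z) (e : P.Side) :
    g (P.target e).1 (P.cornerCoord (P.target e)) = g e.1 (P.sideCoord e 1) := by
  rw [sideCoord_eq, target]
  split_ifs with h
  · simp [cornerCoord, circ_succ_div]
  · simp [cornerCoord]

theorem cornerCoord_mem {P : PolygonalPresentation} {S : Fin P.numFaces → Finset ℂ}
    (hS : ∀ f, ∀ s ∈ S f, ‖s‖ < 1) (c : P.Corner) : P.cornerCoord c ∈ puncturedDisk (S c.1) := by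
  rw [cornerCoord_eq_sideCoord]; exact sideCoord_mem hS _ _

/-- The sign of a side relative to the counterclockwise orientation. -/
def sign (e : P.Side) : ℤ := if P.orientation e then 1 else -1

/-- The cellular coboundary of a function on the vertices. -/
noncomputable def coboundary : (P.Vertex → ℤ) →ₗ[ℤ] (P.Edge → ℤ) where
  toFun m := Quot.lift (fun e => m (P.vertexOf (P.target e)) - m (P.vertexOf (P.source e))) (by
    rintro e _ rfl
    rw [← vertexOf_source, ← vertexOf_target])
  map_add' m m' := by
    funext e
    induction e using Quot.inductionOn with
    | h e => exact add_sub_add_comm _ _ _ _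
  map_smul' r m := by
    funext e
    induction e using Quot.inductionOn with
    | h e => exact (mul_sub r _ _).symm

theorem coboundary_apply (m : P.Vertex → ℤ) (e : P.Side) : P.coboundary m (P.edgeOf e) =
    m (P.vertexOf (P.target e)) - m (P.vertexOf (P.source e)) := rfl

/-- Winding numbers along the edges and around the punctures. -/
abbrev WindingData (S : Fin P.numFaces → Finset ℂ) : Type :=
  (P.Edge → ℤ) × (∀ f, S f → ℤ)

/-- The difference between the total winding number around the punctures of a polygon and the
winding number along its boundary. -/
noncomputable def faceDefect (S : Fin P.numFaces → Finset ℂ) :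
    P.WindingData S →ₗ[ℤ] (Fin P.numFaces → ℤ) where
  toFun m f := ∑ s, m.2 f s - ∑ j, P.sign ⟨f, j⟩ * m.1 (P.edgeOf ⟨f, j⟩)
  map_add' m m' := by
    funext f
    simp only [Prod.fst_add, Prod.snd_add, Pi.add_apply, mul_add, Finset.sum_add_distrib]; ring
  map_smul' r m := by
    funext f
    simp only [Prod.smul_fst, Prod.smul_snd, Pi.smul_apply, smul_eq_mul, RingHom.id_apply, mul_sub,
      Finset.mul_sum]
    congr 1
    exact Finset.sum_congr rfl fun j _ => by ring

end

variable {P : PolygonalPresentation} {S : Fin P.numFaces → Finset ℂ}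

/-- The value of a function at a vertex. -/
noncomputable def vertexValue {Z : Type*} [Zero Z] (G : P.punctured S → Z) : P.Vertex → Z :=
  Quot.lift (fun c => pull G c.1 (P.cornerCoord c)) (by
    rintro _ _ ⟨e, ⟨rfl, rfl⟩ | ⟨rfl, rfl⟩⟩
    · rw [apply_source P (pull G), apply_source P (pull G), pull_side]
    · rw [apply_target P (pull G), apply_target P (pull G), pull_side])

theorem vertexValue_source {Z : Type*} [Zero Z] (G : P.punctured S → Z) (e : P.Side) :
    vertexValue G (P.vertexOf (P.source e)) = pull G e.1 (P.sideCoord e 0) :=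
  apply_source P (pull G) e

theorem vertexValue_target {Z : Type*} [Zero Z] (G : P.punctured S → Z) (e : P.Side) :
    vertexValue G (P.vertexOf (P.target e)) = pull G e.1 (P.sideCoord e 1) :=
  apply_target P (pull G) e

/-- Some lift of `φ` along the side `e` starts at `0` and ends at `n`. -/
def HasEdgeWinding (φ : P.punctured S → UnitAddCircle) (e : P.Side) (n : ℤ) : Prop :=
  ∃ l : unitInterval → ℝ, Continuous l ∧ l 0 = 0 ∧ l 1 = n ∧
    ∀ t, pull φ e.1 (P.sideCoord e t) = (l t : UnitAddCircle)

/-- `φ` winds `k s` times around each puncture `s` of the polygon `f`. -/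
def HasFaceWinding (φ : P.punctured S → UnitAddCircle) (f : Fin P.numFaces) (k : S f → ℤ) : Prop :=
  ∃ g : ℂ → ℝ, ContinuousOn g (puncturedDisk (S f)) ∧
    ∀ z ∈ puncturedDisk (S f), pull φ f z = ∑ s, k s • turn (z - s) + (g z : UnitAddCircle)

/-- `φ` has the winding numbers `m` along the sides and around the punctures. -/
def HasWinding (φ : P.punctured S → UnitAddCircle) (m : P.WindingData S) : Prop :=
  (∀ e, HasEdgeWinding φ e (m.1 (P.edgeOf e))) ∧ ∀ f, HasFaceWinding φ f (m.2 f)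

theorem HasWinding.add {φ φ' : P.punctured S → UnitAddCircle} {m m' : P.WindingData S}
    (h : HasWinding φ m) (h' : HasWinding φ' m') :
    HasWinding (fun y => φ y + φ' y) (m + m') := by
  refine ⟨fun e => ?_, fun f => ?_⟩
  · obtain ⟨l, h1, h2, h3, h4⟩ := h.1 e
    obtain ⟨l', h1', h2', h3', h4'⟩ := h'.1 e
    refine ⟨fun t => l t + l' t, by fun_prop, by simp [h2, h2'], by simp [h3, h3'], fun t => ?_⟩
    rw [pull_add, h4, h4', AddCircle.coe_add]
  · obtain ⟨g, h1, h2⟩ := h.2 f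
    obtain ⟨g', h1', h2'⟩ := h'.2 f
    refine ⟨fun t => g t + g' t, h1.add h1', fun z hz => ?_⟩
    simp only [Prod.snd_add, Pi.add_apply, add_smul, Finset.sum_add_distrib, AddCircle.coe_add]
    rw [pull_add, h2 z hz, h2' z hz]
    abel

theorem HasEdgeWinding.unique {φ : P.punctured S → UnitAddCircle} {e : P.Side} {n n' : ℤ}
    (h : HasEdgeWinding φ e n) (h' : HasEdgeWinding φ e n') : n = n' := by
  obtain ⟨l, h1, h2, h3, h4⟩ := h
  obtain ⟨l', h1', h2', h3', h4'⟩ := h'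
  obtain ⟨c, hc⟩ := (isPreconnected_univ (α := unitInterval)).exists_int_sub_eq
    h1.continuousOn h1'.continuousOn (fun t _ => by rw [← h4, ← h4'])
  have a := hc 0 trivial
  have b := hc 1 trivial
  rw [h2, h2', zero_add] at a
  rw [h3, h3', ← a, add_zero] at b
  exact_mod_cast b

theorem HasFaceWinding.unique (hS : ∀ f, ∀ s ∈ S f, ‖s‖ < 1) {φ : P.punctured S → UnitAddCircle}
    {f : Fin P.numFaces} {k k' : S f → ℤ}
    (h : HasFaceWinding φ f k) (h' : HasFaceWinding φ f k') : k = k' := by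
  classical
  obtain ⟨g, h1, h2⟩ := h
  obtain ⟨g', h1', h2'⟩ := h'
  let K : ℂ → ℤ := fun s => if hs : s ∈ S f then k ⟨s, hs⟩ - k' ⟨s, hs⟩ else 0
  have := winding_unique (hS f) (k := K) (g := fun z => g' z - g z) (h1'.sub h1) (fun z hz => by
    have e : ∑ s ∈ S f, K s • turn (z - s) = ∑ s, k s • turn (z - s) - ∑ s, k' s • turn (z - s) := by
      rw [← Finset.sum_coe_sort, ← Finset.sum_sub_distrib]
      refine Finset.sum_congr rfl fun s _ => ?_
      simp only [K, s.2, dite_true]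
      rw [sub_smul]
    rw [e, AddCircle.coe_sub]
    have a := h2 z hz
    rw [h2' z hz] at a
    rw [sub_eq_sub_iff_add_eq_add, ← a, add_comm])
  funext s
  have a := this s s.2
  simp only [K, s.2, dite_true] at a
  exact sub_eq_zero.1 a

theorem HasWinding.unique (hS : ∀ f, ∀ s ∈ S f, ‖s‖ < 1) {φ : P.punctured S → UnitAddCircle}
    {m m' : P.WindingData S} (h : HasWinding φ m) (h' : HasWinding φ m') : m = m' := by
  refine Prod.ext (funext fun e => ?_) (funext fun f => (h.2 f).unique hS (h'.2 f))
  induction e using Quot.inductionOn with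
  | h e => exact (h.1 e).unique (h'.1 e)

/-- Vanishing at the vertices makes the ends of a lift along a side integers, so that its increment
is a winding number. -/
theorem exists_hasWinding (hS : ∀ f, ∀ s ∈ S f, ‖s‖ < 1) {φ : P.punctured S → UnitAddCircle}
    (hφ : Continuous φ) (h0 : vertexValue φ = 0) : ∃ m, HasWinding φ m := by
  have h1 : ∀ e : P.Side, ∃ n, HasEdgeWinding φ e n := by
    intro e
    obtain ⟨g, hg, hg'⟩ := exists_real_lift_of_convex (convex_univ (E := ℝ))
      (φ := fun x => pull φ e.1 (P.sideCoord e (Set.projIcc 0 1 zero_le_one x)))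
      (((continuousOn_pull hS hφ e.1).comp_continuous (P.continuous_sideCoord e)
        (sideCoord_mem hS e)).comp continuous_projIcc).continuousOn
    have hg'' : ∀ t : unitInterval, pull φ e.1 (P.sideCoord e t) = (g t : UnitAddCircle) := by
      intro t
      rw [← hg' t trivial, Set.projIcc_val]
    have a : ((g 0 : ℝ) : UnitAddCircle) = 0 := by
      have := hg'' 0
      rw [← vertexValue_source, h0] at this
      simpa using this.symm
    have b : ((g 1 : ℝ) : UnitAddCircle) = 0 := by
      have := hg'' 1
      rw [← vertexValue_target, h0] at this
      simpa using this.symm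
    obtain ⟨n, hn⟩ := UnitAddCircle.coe_eq_coe_iff_int.1 (b.trans a.symm)
    refine ⟨n, fun t => g t - g 0, ?_, by simp, by simp [hn], fun t => ?_⟩
    · exact ((continuousOn_univ.1 hg).comp continuous_subtype_val).sub continuous_const
    · rw [AddCircle.coe_sub, a, sub_zero, hg'']
  have h2 : ∀ f, ∃ k, HasFaceWinding φ f k := by
    intro f
    obtain ⟨k, g, hg, h⟩ := exists_winding_of_puncturedDisk (S f) (hS f) (continuousOn_pull hS hφ f)
    exact ⟨fun s => k s, g, hg, fun z hz => by
      rw [h z hz, Finset.sum_coe_sort (S f) (fun s => k s • turn (z - s))]⟩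
  choose n hn using h1
  choose k hk using h2
  -- `φ` agrees on matched sides, so by uniqueness the chosen numbers descend to edges.
  refine ⟨(Quot.lift n ?_, k), fun e => hn e, hk⟩
  rintro e _ rfl
  refine (hn e).unique ?_
  obtain ⟨l, a1, a2, a3, a4⟩ := hn (P.pairing e)
  exact ⟨l, a1, a2, a3, fun t => by rw [pull_side, a4]⟩

end PolygonalPresentation

/-! ### Which winding data occur, and for which maps. -/

namespace PolygonalPresentation

variable {P : PolygonalPresentation} {S : Fin P.numFaces → Finset ℂ}

theorem circ_mem_puncturedDisk (hS : ∀ f, ∀ s ∈ S f, ‖s‖ < 1) (f : Fin P.numFaces) (x : ℝ) :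
    circ x ∈ puncturedDisk (S f) :=
  ⟨by simp [norm_circ], fun h => (hS _ _ h).ne (norm_circ x)⟩

theorem sum_turn_circ (hS : ∀ f, ∀ s ∈ S f, ‖s‖ < 1) (f : Fin P.numFaces) (k : S f → ℤ) (x : ℝ) :
    ∑ s, k s • turn (circ x - s) = ((∑ s, k s * circAngle s x : ℝ) : UnitAddCircle) := by
  rw [QuotientAddGroup.mk_sum]
  refine Finset.sum_congr rfl fun s _ => ?_
  rw [turn_circ_sub (hS f s s.2), ← AddCircle.coe_zsmul, zsmul_eq_mul]

theorem continuous_sum_circAngle (hS : ∀ f, ∀ s ∈ S f, ‖s‖ < 1) (f : Fin P.numFaces)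
    (k : S f → ℤ) : Continuous fun x : ℝ => ∑ s, (k s : ℝ) * circAngle s x :=
  continuous_finsetSum _ fun s _ => continuous_const.mul (continuous_circAngle (hS f s s.2))

theorem sum_circAngle_one (f : Fin P.numFaces) (k : S f → ℤ) :
    ∑ s, (k s : ℝ) * circAngle s 1 = ∑ s, (k s : ℝ) * circAngle s 0 + (∑ s, k s : ℤ) := by
  simp only [circAngle_one, mul_add, Finset.sum_add_distrib, mul_one]
  push_cast; ring

/-- Lift `φ` along the boundary circle to `L`. Its increment over one turn is the total winding
around the punctures, and by telescoping it is also the signed sum of the windings along the sides.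
-/
theorem HasWinding.faceDefect_eq_zero (hS : ∀ f, ∀ s ∈ S f, ‖s‖ < 1)
    {φ : P.punctured S → UnitAddCircle} {m : P.WindingData S} (h : HasWinding φ m) :
    P.faceDefect S m = 0 := by
  funext f
  obtain ⟨g, hg, hg'⟩ := h.2 f
  set N := P.sides f with hN
  have hN0 : (N : ℝ) ≠ 0 := NeZero.ne _
  let L : ℝ → ℝ := fun x => ∑ s, (m.2 f s : ℝ) * circAngle s x + g (circ x)
  have hL : Continuous L := (continuous_sum_circAngle hS f _).add
    (hg.comp_continuous continuous_circ (circ_mem_puncturedDisk hS f))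
  have hL' : ∀ x, pull φ f (circ x) = (L x : UnitAddCircle) := fun x => by
    rw [hg' _ (circ_mem_puncturedDisk hS f x), sum_turn_circ hS, ← AddCircle.coe_add]
  have hL1 : L 1 = L 0 + (∑ s, m.2 f s : ℤ) := by
    simp only [L, sum_circAngle_one, circ_one, circ_zero]; ring
  have hside : ∀ j : Fin N, L (((j : ℕ) + 1 : ℕ) / N) - L ((j : ℕ) / N) =
      P.sign ⟨f, j⟩ * m.1 (P.edgeOf ⟨f, j⟩) := by
    intro j
    obtain ⟨l, l1, l2, l3, l4⟩ := h.1 ⟨f, j⟩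
    obtain ⟨c, hc⟩ := (isPreconnected_univ (α := unitInterval)).exists_int_sub_eq
      l1.continuousOn (g := fun t : unitInterval =>
        L (((j : ℕ) + (if P.orientation ⟨f, j⟩ then (t : ℝ) else 1 - (t : ℝ))) / N))
      (hL.comp (by split_ifs <;> fun_prop)).continuousOn (fun t _ => by
        rw [← l4, ← hL']; rfl)
    have a := hc 0 trivial
    have b := hc 1 trivial
    rw [l2] at a
    rw [l3] at b
    unfold sign
    split_ifs at a b ⊢
    · simp at a b ⊢; linarith
    · simp at a b ⊢; linarith
  have hsum : ∑ j : Fin N, (L (((j : ℕ) + 1 : ℕ) / N) - L ((j : ℕ) / N)) = L 1 - L 0 := by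
    rw [Fin.sum_univ_eq_sum_range (fun i : ℕ => L ((i + 1 : ℕ) / N) - L ((i : ℕ) / N)),
      Finset.sum_range_sub (fun i : ℕ => L ((i : ℕ) / N))]
    simp [hN0]
  rw [Finset.sum_congr rfl fun j _ => hside j, hL1, add_sub_cancel_left] at hsum
  have : (∑ j, P.sign ⟨f, j⟩ * m.1 (P.edgeOf ⟨f, j⟩) : ℤ) = ∑ s, m.2 f s := by exact_mod_cast hsum
  show ∑ s, m.2 f s - ∑ j, P.sign ⟨f, j⟩ * m.1 (P.edgeOf ⟨f, j⟩) = 0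
  rw [this, sub_self]

theorem vertexValue_eq_zero_of_forall_side {Z : Type*} [Zero Z] {G : P.punctured S → Z}
    (h : ∀ e, pull G e.1 (P.sideCoord e 0) = 0 ∧ pull G e.1 (P.sideCoord e 1) = 0) :
    vertexValue G = 0 := by
  funext v
  induction v using Quot.inductionOn with
  | h c =>
    show pull G c.1 (P.cornerCoord c) = 0
    rw [cornerCoord_eq_sideCoord]
    split_ifs
    · exact (h c).1
    · exact (h c).2

/-- On each polygon take the sum of angles around the punctures, with the prescribed multiplicities,
and add a real function chosen so that the result on each side `e` is `t ↦ m.1 e * t`. The boundary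
values of that real function close up because the face defect is zero. -/
theorem exists_hasWinding_of_faceDefect_eq_zero (hS : ∀ f, ∀ s ∈ S f, ‖s‖ < 1)
    {m : P.WindingData S} (hm : P.faceDefect S m = 0) :
    ∃ φ : C(P.punctured S, UnitAddCircle), vertexValue φ = 0 ∧ HasWinding φ m := by
  classical
  let a : ∀ f : Fin P.numFaces, ℕ → ℤ := fun f i =>
    if h : i < P.sides f then P.sign ⟨f, ⟨i, h⟩⟩ * m.1 (P.edgeOf ⟨f, ⟨i, h⟩⟩) else 0
  have ha : ∀ f (j : Fin (P.sides f)), a f j = P.sign ⟨f, j⟩ * m.1 (P.edgeOf ⟨f, j⟩) :=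
    fun f j => dif_pos j.2
  have htot : ∀ f, ∑ i ∈ Finset.range (P.sides f), a f i = ∑ s, m.2 f s := by
    intro f
    rw [Finset.sum_range, Finset.sum_congr rfl fun j _ => ha f j]
    exact (sub_eq_zero.1 (congrFun hm f)).symm
  -- The required boundary values: winding accumulated up to corner `j`, plus its linear growth
  -- along side `j`, minus the angle contributed by the punctures.
  let b : ∀ f : Fin P.numFaces, Fin (P.sides f) → ℝ → ℝ := fun f j x =>
    (∑ i ∈ Finset.range j, a f i : ℤ) + a f j * x -
      ∑ s, (m.2 f s : ℝ) * circAngle s (((j : ℕ) + x) / P.sides f)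
  have hfill : ∀ f, ∃ g : ℂ → ℝ, Continuous g ∧ ∀ (j : Fin (P.sides f)) (t : unitInterval),
      g (circ (((j : ℕ) + (t : ℝ)) / P.sides f)) = b f j t := by
    intro f
    have hN0 : (P.sides f : ℝ) ≠ 0 := NeZero.ne _
    refine exists_real_fill (fun j t => b f j t) (fun j => ?_) (fun j => ?_)
    · have := continuous_sum_circAngle hS f (m.2 f)
      refine Continuous.sub (by fun_prop) (this.comp (by fun_prop))
    · have hval : ((j + 1 : Fin (P.sides f)) : ℕ) = ((j : ℕ) + 1) % P.sides f := by
        rw [Fin.val_add, Fin.val_one', Nat.add_mod_mod]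
      simp only [b, hval, Set.Icc.coe_one, Set.Icc.coe_zero, mul_one, mul_zero, add_zero]
      rcases Nat.lt_or_ge ((j : ℕ) + 1) (P.sides f) with h | h
      · rw [Nat.mod_eq_of_lt h, Finset.sum_range_succ]; push_cast; ring
      -- Back at corner 0 the accumulated winding cancels the full turns of the angles; this is the
      -- vanishing face defect.
      · have h' : (j : ℕ) + 1 = P.sides f := le_antisymm j.2 h
        have h'' : ((j : ℕ) : ℝ) + 1 = P.sides f := by exact_mod_cast h'
        have e := htot f
        rw [← h', Finset.sum_range_succ] at e
        have e' : ((∑ i ∈ Finset.range j, a f i : ℤ) : ℝ) + a f j = (∑ s, m.2 f s : ℤ) := by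
          exact_mod_cast e
        rw [e', h', Nat.mod_self, h'', div_self hN0, sum_circAngle_one]
        simp
  choose g hg hg' using hfill
  let G : Fin P.numFaces → ℂ → UnitAddCircle := fun f z =>
    ∑ s, m.2 f s • turn (z - s) + (g f z : UnitAddCircle)
  have hG : ∀ f, ContinuousOn (G f) (puncturedDisk (S f)) := by
    intro f
    refine ContinuousOn.add (continuousOn_finsetSum _ fun s _ => ContinuousOn.zsmul
      (continuousOn_turn_sub fun h => h.2 s.2) _) ?_
    exact ((AddCircle.continuous_mk' 1).comp (hg f)).continuousOn
  -- A clockwise side replaces `t` by `1 - t` and flips the sign; the two effects agree modulo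
  -- integers, so the value depends only on the edge.
  have hGside : ∀ (e : P.Side) (t : unitInterval),
      G e.1 (P.sideCoord e t) = ((m.1 (P.edgeOf e) * t : ℝ) : UnitAddCircle) := by
    rintro ⟨f, j⟩ t
    have key : ∀ x : unitInterval, G f (circ (((j : ℕ) + (x : ℝ)) / P.sides f)) =
        ((P.sign ⟨f, j⟩ * m.1 (P.edgeOf ⟨f, j⟩) * x : ℝ) : UnitAddCircle) := by
      intro x
      simp only [G]
      rw [sum_turn_circ hS, hg', ← AddCircle.coe_add, UnitAddCircle.coe_eq_coe_iff_int]
      refine ⟨∑ i ∈ Finset.range j, a f i, ?_⟩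
      simp only [b, ha]; push_cast; ring
    rw [sideCoord_eq]
    by_cases ho : P.orientation ⟨f, j⟩
    · simp only [ho, if_true]
      rw [key t]; simp [sign, ho]
    · have := key (unitInterval.symm t)
      rw [unitInterval.coe_symm_eq] at this
      simp only [ho]
      refine this.trans ?_
      rw [UnitAddCircle.coe_eq_coe_iff_int]
      refine ⟨-m.1 (P.edgeOf ⟨f, j⟩), ?_⟩
      simp [sign, ho]; ring
  obtain ⟨φ, hφ⟩ := exists_pull_eq hS G hG (fun e t => by
    rw [hGside, hGside, edgeOf_pairing])
  have hφside : ∀ (e : P.Side) (t : unitInterval), pull φ e.1 (P.sideCoord e t) =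
      ((m.1 (P.edgeOf e) * t : ℝ) : UnitAddCircle) := fun e t => by
    rw [hφ _ _ (sideCoord_mem hS e t), hGside]
  refine ⟨φ, vertexValue_eq_zero_of_forall_side fun e => ⟨?_, ?_⟩, fun e => ?_, fun f => ?_⟩
  · rw [hφside]; simp
  · rw [hφside]; simp [UnitAddCircle.coe_intCast]
  · exact ⟨fun t => m.1 (P.edgeOf e) * t, by fun_prop, by simp, by simp, hφside e⟩
  · exact ⟨g f, (hg f).continuousOn, fun z hz => hφ f z hz⟩

/-- Interpolate linearly along the sides and fill in the polygons. Subtracting such maps moves a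
circle-valued map to one vanishing at the vertices. -/
theorem exists_vertexValue_eq (hS : ∀ f, ∀ s ∈ S f, ‖s‖ < 1) (m : P.Vertex → ℝ) :
    ∃ F : C(P.punctured S, ℝ), vertexValue F = m := by
  have hfill : ∀ f, ∃ g : ℂ → ℝ, Continuous g ∧ ∀ (j : Fin (P.sides f)) (t : unitInterval),
      g (circ (((j : ℕ) + (t : ℝ)) / P.sides f)) =
        m (P.vertexOf ⟨f, j⟩) * (1 - t) + m (P.vertexOf ⟨f, j + 1⟩) * t := fun f =>
    exists_real_fill (fun (j : Fin (P.sides f)) (t : unitInterval) =>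
      m (P.vertexOf ⟨f, j⟩) * (1 - t) + m (P.vertexOf ⟨f, j + 1⟩) * t)
      (fun j => by fun_prop) (fun j => by simp)
  choose g hg hg' using hfill
  have hside : ∀ (e : P.Side) (t : unitInterval), g e.1 (P.sideCoord e t) =
      m (P.vertexOf (P.source e)) * (1 - t) + m (P.vertexOf (P.target e)) * t := by
    rintro ⟨f, j⟩ t
    rw [sideCoord_eq]
    by_cases ho : P.orientation ⟨f, j⟩
    · simp only [ho, if_true, hg', source, target]
    · have := hg' f j (unitInterval.symm t)
      rw [unitInterval.coe_symm_eq] at this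
      simp only [ho, source, target]
      refine this.trans ?_
      simp; ring
  obtain ⟨F, hF⟩ := exists_pull_eq hS g (fun f => (hg f).continuousOn) (fun e t => by
    rw [hside, hside, vertexOf_source, vertexOf_target])
  refine ⟨F, funext fun v => ?_⟩
  induction v using Quot.inductionOn with
  | h c =>
    show pull F c.1 (P.cornerCoord c) = m (P.vertexOf c)
    rw [hF _ _ (cornerCoord_mem hS c), cornerCoord_eq_sideCoord, hside]
    by_cases ho : P.orientation c <;> simp [ho, source, target]

/-- Without winding around punctures `φ` lifts on each polygon, and without winding along edges the
lift takes one value at all corners. That value is an integer; subtracting it makes the lifts agree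
on matched sides. -/
theorem exists_real_lift_of_hasWinding_zero (hS : ∀ f, ∀ s ∈ S f, ‖s‖ < 1)
    {φ : P.punctured S → UnitAddCircle} (h0 : vertexValue φ = 0) (h : HasWinding φ 0) :
    ∃ F : C(P.punctured S, ℝ), ∀ y, φ y = (F y : UnitAddCircle) := by
  choose l l1 l2 l3 l4 using h.1
  choose g g1 g2 using h.2
  simp only [Prod.snd_zero, Pi.zero_apply, zero_smul, Finset.sum_const_zero, zero_add] at g2
  have hl : ∀ (e : P.Side) t, g e.1 (P.sideCoord e t) = l e t + g e.1 (P.sideCoord e 0) := by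
    intro e t
    obtain ⟨c, hc⟩ := (isPreconnected_univ (α := unitInterval)).exists_int_sub_eq
      (f := fun t => g e.1 (P.sideCoord e t))
      ((g1 e.1).comp_continuous (P.continuous_sideCoord e) (sideCoord_mem hS e)).continuousOn
      (l1 e).continuousOn (fun t _ => by
        rw [← l4, g2 _ _ (sideCoord_mem hS e t)])
    rw [hc t trivial, hc 0 trivial, l2, zero_add]
  have hcorner : ∀ f (j : Fin (P.sides f)),
      g f (P.cornerCoord ⟨f, j⟩) = g f (P.cornerCoord ⟨f, 0⟩) := by
    intro f
    refine Fin.eq_zero_apply_of_succ fun j => ?_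
    have a := apply_source P g ⟨f, j⟩
    have b := apply_target P g ⟨f, j⟩
    rw [hl ⟨f, j⟩ 1, l3] at b
    simp only [Prod.fst_zero, Pi.zero_apply, Int.cast_zero, zero_add] at b
    rw [← a] at b
    by_cases ho : P.orientation ⟨f, j⟩
    · simpa [source, target, ho] using b
    · simpa [source, target, ho] using b.symm
  have hint : ∀ f, ((g f (P.cornerCoord ⟨f, 0⟩) : ℝ) : UnitAddCircle) = 0 := by
    intro f
    rw [← g2 f _ (cornerCoord_mem hS ⟨f, 0⟩)]
    exact congrFun h0 (P.vertexOf ⟨f, 0⟩)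
  have hll : ∀ e t, l e t = l (P.pairing e) t := by
    intro e t
    obtain ⟨c, hc⟩ := (isPreconnected_univ (α := unitInterval)).exists_int_sub_eq
      (l1 e).continuousOn (l1 (P.pairing e)).continuousOn (fun t _ => by
        rw [← l4, ← l4, pull_side])
    have a := hc 0 trivial
    rw [l2, l2, zero_add] at a
    rw [hc t trivial, ← a, add_zero]
  have hg' : ∀ (e : P.Side) t, g e.1 (P.sideCoord e t) - g e.1 (P.cornerCoord ⟨e.1, 0⟩) = l e t := by
    intro e t
    have : g e.1 (P.sideCoord e 0) = g e.1 (P.cornerCoord ⟨e.1, 0⟩) := by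
      rw [← apply_source P g e]
      unfold source
      split_ifs
      · exact hcorner _ _
      · exact hcorner _ _
    rw [hl, this, add_sub_cancel_right]
  obtain ⟨F, hF⟩ := exists_pull_eq hS (fun f z => g f z - g f (P.cornerCoord ⟨f, 0⟩))
    (fun f => (g1 f).sub continuousOn_const) (fun e t => by rw [hg', hg', hll])
  refine ⟨F, congrFun (eq_of_pull_eq hS fun f z hz => ?_)⟩
  rw [pull_comp (fun x : ℝ => (x : UnitAddCircle)) (by simp), hF f z hz, g2 f z hz,
    AddCircle.coe_sub, hint, sub_zero]

/-- The map itself is a lift, so its winding along an edge is the difference of its end values, and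
it does not wind around any puncture. -/
theorem hasWinding_of_real_lift (hS : ∀ f, ∀ s ∈ S f, ‖s‖ < 1) (F : C(P.punctured S, ℝ))
    (m : P.Vertex → ℤ) (hm : ∀ v, vertexValue F v = m v) :
    HasWinding (fun y => (F y : UnitAddCircle)) (P.coboundary m, 0) := by
  refine ⟨fun e => ?_, fun f => ?_⟩
  · refine ⟨fun t => pull F e.1 (P.sideCoord e t) - pull F e.1 (P.sideCoord e 0), ?_, by simp, ?_,
      fun t => ?_⟩
    · exact ((continuousOn_pull hS F.continuous e.1).comp_continuous (P.continuous_sideCoord e)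
        (sideCoord_mem hS e)).sub continuous_const
    · show pull F e.1 (P.sideCoord e 1) - pull F e.1 (P.sideCoord e 0) =
        ((P.coboundary m (P.edgeOf e) : ℤ) : ℝ)
      rw [← vertexValue_source, ← vertexValue_target, hm, hm, coboundary_apply]; push_cast; ring
    · rw [pull_comp (fun x : ℝ => (x : UnitAddCircle)) (by simp), AddCircle.coe_sub,
        ← vertexValue_source, hm, UnitAddCircle.coe_intCast, sub_zero]
  · refine ⟨pull F f, continuousOn_pull hS F.continuous f, fun z hz => ?_⟩
    rw [pull_comp (fun x : ℝ => (x : UnitAddCircle)) (by simp)]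
    simp

end PolygonalPresentation

/-! ### H⁰, H¹ and the rank count. -/

/-- Reduction of real-valued functions modulo the integers. -/
noncomputable def toCircleMap (Y : Type*) [TopologicalSpace Y] :
    C(Y, ℝ) →ₗ[ℤ] C(Y, UnitAddCircle) :=
  AddMonoidHom.toIntLinearMap
    { toFun := fun F => ⟨fun y => (F y : UnitAddCircle), (AddCircle.continuous_mk' 1).comp F.continuous⟩
      map_zero' := by ext; simp
      map_add' := fun F G => ContinuousMap.ext fun y => AddCircle.coe_add 1 (F y) (G y) }

/-- The rank of `H⁰` minus the rank of `H¹`. -/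
noncomputable def cohomologyRank (Y : Type*) [TopologicalSpace Y] : ℤ :=
  (Module.finrank ℤ C(Y, ℤ) : ℤ) -
    Module.finrank ℤ (C(Y, UnitAddCircle) ⧸ LinearMap.range (toCircleMap Y))

theorem LinearMap.int_finrank_range_add_finrank_ker {M M' : Type*} [AddCommGroup M]
    [AddCommGroup M'] [Module.Finite ℤ M] (f : M →ₗ[ℤ] M') :
    Module.finrank ℤ (LinearMap.range f) + Module.finrank ℤ (LinearMap.ker f) =
      Module.finrank ℤ M := by
  rw [← f.quotKerEquivRange.finrank_eq, Submodule.finrank_quotient_add_finrank]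

/-- Precomposition with a homeomorphism. -/
def Homeomorph.arrowCongrLinear {Y Y' : Type*} [TopologicalSpace Y] [TopologicalSpace Y']
    (h : Y ≃ₜ Y') (A : Type*) [AddCommGroup A] [TopologicalSpace A] [IsTopologicalAddGroup A] :
    C(Y, A) ≃ₗ[ℤ] C(Y', A) :=
  AddEquiv.toIntLinearEquiv
    { toFun := fun F => F.comp (h.symm : C(Y', Y))
      invFun := fun F => F.comp (h : C(Y, Y'))
      left_inv := fun F => by ext; simp
      right_inv := fun F => by ext; simp
      map_add' := fun F G => by ext; simp }

theorem Homeomorph.cohomologyRank_eq {Y Y' : Type*} [TopologicalSpace Y] [TopologicalSpace Y']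
    (h : Y ≃ₜ Y') : cohomologyRank Y = cohomologyRank Y' := by
  unfold cohomologyRank
  rw [(h.arrowCongrLinear ℤ).finrank_eq, (Submodule.Quotient.equiv (LinearMap.range (toCircleMap Y))
    (LinearMap.range (toCircleMap Y')) (h.arrowCongrLinear UnitAddCircle) ?_).finrank_eq]
  ext φ
  constructor
  · rintro ⟨_, ⟨F, rfl⟩, rfl⟩
    exact ⟨h.arrowCongrLinear ℝ F, rfl⟩
  · rintro ⟨F, rfl⟩
    refine ⟨_, ⟨(h.arrowCongrLinear ℝ).symm F, rfl⟩, ?_⟩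
    ext y
    show ((F (h (h.symm y)) : ℝ) : UnitAddCircle) = F y
    rw [h.apply_symm_apply]

namespace PolygonalPresentation

variable {P : PolygonalPresentation} {S : Fin P.numFaces → Finset ℂ}

theorem vertexValue_add {Z : Type*} [AddMonoid Z] (G G' : P.punctured S → Z) :
    vertexValue (fun y => G y + G' y) = vertexValue G + vertexValue G' := by
  funext v
  induction v using Quot.inductionOn with
  | h c => exact pull_add G G' _ _

theorem vertexValue_comp {Z Z' : Type*} [Zero Z] [Zero Z'] (u : Z → Z') (hu : u 0 = 0)
    (G : P.punctured S → Z) (v : P.Vertex) :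
    vertexValue (fun y => u (G y)) v = u (vertexValue G v) := by
  induction v using Quot.inductionOn with
  | h c => exact pull_comp u hu G _ _

/-- Evaluation at the vertices. -/
noncomputable def vertexValueHom (S : Fin P.numFaces → Finset ℂ) (Z : Type*) [AddCommGroup Z]
    [TopologicalSpace Z] [IsTopologicalAddGroup Z] : C(P.punctured S, Z) →ₗ[ℤ] (P.Vertex → Z) :=
  AddMonoidHom.toIntLinearMap
    (AddMonoidHom.mk' (fun G => vertexValue G) fun G G' => vertexValue_add G G')

theorem vertexValueHom_apply {Z : Type*} [AddCommGroup Z]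
    [TopologicalSpace Z] [IsTopologicalAddGroup Z] (G : C(P.punctured S, Z)) :
    vertexValueHom S Z G = vertexValue G := rfl

/-- Such a map is constant on each punctured polygon, hence determined by its vertex values; a
vertex function arises when it agrees at the two ends of each edge. -/
theorem finrank_integer_maps (hS : ∀ f, ∀ s ∈ S f, ‖s‖ < 1) :
    Module.finrank ℤ C(P.punctured S, ℤ) = Module.finrank ℤ (LinearMap.ker P.coboundary) := by
  have hconst : ∀ (G : C(P.punctured S, ℤ)) f, ∀ z ∈ puncturedDisk (S f),
      ∀ w ∈ puncturedDisk (S f), pull G f z = pull G f w := fun G f z hz w hw =>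
    (isPreconnected_puncturedDisk (hS f)).constant (continuousOn_pull hS G.continuous f) hz hw
  have hinj : Function.Injective (vertexValueHom S ℤ) := by
    intro G G' h
    refine DFunLike.coe_injective (eq_of_pull_eq hS fun f z hz => ?_)
    rw [hconst G f z hz _ (cornerCoord_mem hS ⟨f, 0⟩), hconst G' f z hz _ (cornerCoord_mem hS ⟨f, 0⟩)]
    exact congrFun h (P.vertexOf ⟨f, 0⟩)
  have hrange : LinearMap.range (vertexValueHom S ℤ) = LinearMap.ker P.coboundary := by
    ext m
    constructor
    · rintro ⟨G, rfl⟩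
      rw [LinearMap.mem_ker]
      funext e
      induction e using Quot.inductionOn with
      | h e =>
        show P.coboundary (vertexValue G) (P.edgeOf e) = 0
        rw [coboundary_apply, vertexValue_target, vertexValue_source, sub_eq_zero]
        exact hconst G _ _ (sideCoord_mem hS _ _) _ (sideCoord_mem hS _ _)
    · intro hm
      have hm' : ∀ e : P.Side, m (P.vertexOf (P.target e)) = m (P.vertexOf (P.source e)) := fun e =>
        sub_eq_zero.1 (congrFun (LinearMap.mem_ker.1 hm) (P.edgeOf e))
      have hcorner : ∀ f (j : Fin (P.sides f)), m (P.vertexOf ⟨f, j⟩) = m (P.vertexOf ⟨f, 0⟩) := by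
        intro f
        refine Fin.eq_zero_apply_of_succ (h := fun j => m (P.vertexOf ⟨f, j⟩)) fun j => ?_
        have := hm' ⟨f, j⟩
        unfold source target at this
        split_ifs at this
        · exact this
        · exact this.symm
      have hsrc : ∀ e : P.Side, m (P.vertexOf ⟨e.1, 0⟩) = m (P.vertexOf (P.source e)) := by
        intro e
        unfold source
        split_ifs <;> exact (hcorner _ _).symm
      obtain ⟨G, hG⟩ := exists_pull_eq hS (fun f _ => m (P.vertexOf ⟨f, 0⟩))
        (fun f => continuousOn_const) (fun e t => by rw [hsrc, hsrc, vertexOf_source])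
      refine ⟨G, funext fun v => ?_⟩
      induction v using Quot.inductionOn with
      | h c =>
        show pull G c.1 (P.cornerCoord c) = m (P.vertexOf c)
        rw [hG _ _ (cornerCoord_mem hS c), ← hcorner c.1 c.2]
  rw [← hrange, LinearMap.finrank_range_of_inj hinj]

/-- One puncture in the polygon can absorb any prescribed defect, which is why every polygon must be
punctured. -/
theorem surjective_faceDefect (hne : ∀ f, (S f).Nonempty) :
    Function.Surjective (P.faceDefect S) := by
  classical
  intro c
  refine ⟨(0, fun f s => if s = ⟨_, (hne f).choose_spec⟩ then c f else 0), funext fun f => ?_⟩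
  simp [faceDefect]

theorem finrank_ker_faceDefect (hne : ∀ f, (S f).Nonempty) :
    (Module.finrank ℤ (LinearMap.ker (P.faceDefect S)) : ℤ) =
      Nat.card P.Edge + ∑ f, ((S f).card : ℤ) - P.numFaces := by
  classical
  have := Fintype.ofFinite P.Edge
  have h := (P.faceDefect S).int_finrank_range_add_finrank_ker
  rw [LinearMap.range_eq_top.2 (surjective_faceDefect hne), finrank_top,
    Module.finrank_fintype_fun_eq_card, Fintype.card_fin, Module.finrank_prod,
    Module.finrank_fintype_fun_eq_card, Module.finrank_pi_fintype] at h
  simp only [Module.finrank_fintype_fun_eq_card, Fintype.card_coe] at h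
  rw [Nat.card_eq_fintype_card]
  have h' : (P.numFaces : ℤ) + Module.finrank ℤ (LinearMap.ker (P.faceDefect S)) =
    Fintype.card P.Edge + ∑ f, ((S f).card : ℤ) := by exact_mod_cast h
  linarith

theorem finrank_range_coboundary :
    Module.finrank ℤ (LinearMap.range P.coboundary) + Module.finrank ℤ (LinearMap.ker P.coboundary) =
      Nat.card P.Vertex := by
  have := Fintype.ofFinite P.Vertex
  rw [P.coboundary.int_finrank_range_add_finrank_ker, Module.finrank_fintype_fun_eq_card,
    Nat.card_eq_fintype_card]

/-- Winding data of circle-valued maps that vanish at the vertices. -/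
theorem exists_windingHom (hS : ∀ f, ∀ s ∈ S f, ‖s‖ < 1) :
    ∃ W : LinearMap.ker (vertexValueHom S UnitAddCircle) →ₗ[ℤ] LinearMap.ker (P.faceDefect S),
      ∀ φ, HasWinding φ.1 (W φ : P.WindingData S) := by
  have h : ∀ φ : LinearMap.ker (vertexValueHom S UnitAddCircle),
      ∃ m : LinearMap.ker (P.faceDefect S),
        HasWinding φ.1 (m : P.WindingData S) := fun φ => by
    obtain ⟨m, hm⟩ := exists_hasWinding hS φ.1.continuous (LinearMap.mem_ker.1 φ.2)
    exact ⟨⟨m, LinearMap.mem_ker.2 (hm.faceDefect_eq_zero hS)⟩, hm⟩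
  choose W hW using h
  exact ⟨AddMonoidHom.toIntLinearMap (AddMonoidHom.mk' W fun φ φ' =>
    Subtype.ext ((hW (φ + φ')).unique hS ((hW φ).add (hW φ')))), hW⟩

/-- H¹ is the kernel of `faceDefect` modulo coboundaries: the maps vanishing at the vertices surject
onto both quotients, via `A` and `B`, with the same kernel. -/
theorem finrank_circle_maps (hS : ∀ f, ∀ s ∈ S f, ‖s‖ < 1) :
    Module.finrank ℤ (C(P.punctured S, UnitAddCircle) ⧸ LinearMap.range (toCircleMap (P.punctured S)))
      + Module.finrank ℤ (LinearMap.range P.coboundary) =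
      Module.finrank ℤ (LinearMap.ker (P.faceDefect S)) := by
  obtain ⟨W, hW⟩ := exists_windingHom hS
  let R := LinearMap.range (toCircleMap (P.punctured S))
  -- A coboundary is the winding data of an actual map, so its face defect vanishes without any
  -- combinatorics.
  have hδ : ∀ m : P.Vertex → ℤ, P.faceDefect S (P.coboundary m, 0) = 0 := by
    intro m
    obtain ⟨F, hF⟩ := exists_vertexValue_eq hS (fun v => (m v : ℝ))
    exact (hasWinding_of_real_lift hS F m (congrFun hF)).faceDefect_eq_zero hS
  let δ : (P.Vertex → ℤ) →ₗ[ℤ] LinearMap.ker (P.faceDefect S) :=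
    ((LinearMap.inl ℤ _ _).comp P.coboundary).codRestrict _ fun m => LinearMap.mem_ker.2 (hδ m)
  let A : LinearMap.ker (vertexValueHom S UnitAddCircle) →ₗ[ℤ]
      C(P.punctured S, UnitAddCircle) ⧸ R := R.mkQ.comp (Submodule.subtype _)
  let B : LinearMap.ker (vertexValueHom S UnitAddCircle) →ₗ[ℤ]
      LinearMap.ker (P.faceDefect S) ⧸ LinearMap.range δ := (LinearMap.range δ).mkQ.comp W
  have hA : Function.Surjective A := by
    intro x
    obtain ⟨φ, rfl⟩ := R.mkQ_surjective x
    choose r hr using fun v : P.Vertex =>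
      (QuotientAddGroup.mk_surjective (vertexValue φ v) : ∃ r : ℝ, (r : UnitAddCircle) = _)
    obtain ⟨F, hF⟩ := exists_vertexValue_eq hS r
    refine ⟨⟨φ - toCircleMap _ F, ?_⟩, ?_⟩
    · rw [LinearMap.mem_ker, map_sub, sub_eq_zero]
      funext v
      rw [vertexValueHom_apply, vertexValueHom_apply, ← hr, ← hF]
      exact (vertexValue_comp (fun x : ℝ => (x : UnitAddCircle)) (by simp) F v).symm
    · show R.mkQ (φ - toCircleMap _ F) = R.mkQ φ
      rw [map_sub, sub_eq_self, Submodule.mkQ_apply, Submodule.Quotient.mk_eq_zero]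
      exact ⟨F, rfl⟩
  have hWs : Function.Surjective W := by
    rintro ⟨m, hm⟩
    obtain ⟨φ, h0, h⟩ := exists_hasWinding_of_faceDefect_eq_zero hS (LinearMap.mem_ker.1 hm)
    exact ⟨⟨φ, LinearMap.mem_ker.2 h0⟩, Subtype.ext ((hW _).unique hS h)⟩
  have hB : Function.Surjective B := (Submodule.mkQ_surjective _).comp hWs
  have hker : LinearMap.ker A = LinearMap.ker B := by
    ext φ
    rw [LinearMap.mem_ker, LinearMap.mem_ker]
    show R.mkQ φ.1 = 0 ↔ (LinearMap.range δ).mkQ (W φ) = 0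
    rw [Submodule.mkQ_apply, Submodule.mkQ_apply, Submodule.Quotient.mk_eq_zero,
      Submodule.Quotient.mk_eq_zero]
    constructor
    · rintro ⟨F, hF⟩
      have hm : ∀ v, ∃ n : ℤ, (n : ℝ) = vertexValue F v := fun v => by
        rw [← UnitAddCircle.coe_eq_zero_iff_int,
          ← vertexValue_comp (fun x : ℝ => (x : UnitAddCircle)) (by simp) F v]
        have := congrFun (LinearMap.mem_ker.1 φ.2) v
        rwa [← hF] at this
      choose m hm using hm
      refine ⟨m, Subtype.ext ?_⟩
      refine (hasWinding_of_real_lift hS F m fun v => (hm v).symm).unique hS ?_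
      have := hW φ
      rwa [← hF] at this
    · rintro ⟨m, hm⟩
      obtain ⟨F, hF⟩ := exists_vertexValue_eq hS (fun v => (m v : ℝ))
      have h1 := hasWinding_of_real_lift hS F m (congrFun hF)
      have hmem : toCircleMap _ F ∈ LinearMap.ker (vertexValueHom S UnitAddCircle) := by
        rw [LinearMap.mem_ker]
        funext v
        refine (vertexValue_comp (fun x : ℝ => (x : UnitAddCircle)) (by simp) F v).trans ?_
        rw [hF]; exact UnitAddCircle.coe_intCast _
      -- After subtracting a liftable map with the same winding data, no winding remains and the
      -- difference lifts too.
      have h2 : W (φ - ⟨_, hmem⟩) = 0 := by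
        rw [map_sub, sub_eq_zero, ← hm]
        exact Subtype.ext (h1.unique hS (hW ⟨_, hmem⟩))
      have h3 := hW (φ - ⟨_, hmem⟩)
      rw [h2] at h3
      obtain ⟨F', hF'⟩ := exists_real_lift_of_hasWinding_zero hS
        (LinearMap.mem_ker.1 (φ - ⟨_, hmem⟩).2) h3
      refine ⟨F' + F, ?_⟩
      rw [map_add]
      refine (sub_eq_iff_eq_add.1 ?_).symm
      ext y
      exact hF' y
  have e := ((A.quotKerEquivOfSurjective hA).symm.trans
    (Submodule.quotEquivOfEq _ _ hker)).trans (B.quotKerEquivOfSurjective hB)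
  rw [e.finrank_eq]
  have hrk : Module.finrank ℤ (LinearMap.range P.coboundary) =
      Module.finrank ℤ (LinearMap.range δ) := by
    have e1 : LinearMap.range ((LinearMap.ker (P.faceDefect S)).subtype.comp δ) =
        (LinearMap.range P.coboundary).map (LinearMap.inl ℤ (P.Edge → ℤ) (∀ f, S f → ℤ)) := by
      rw [← LinearMap.range_comp]; rfl
    rw [LinearMap.range_comp] at e1
    have e2 := (Submodule.equivMapOfInjective _ (Submodule.injective_subtype
      (LinearMap.ker (P.faceDefect S))) (LinearMap.range δ)).finrank_eq
    have e3 := (Submodule.equivMapOfInjective (LinearMap.inl ℤ (P.Edge → ℤ) (∀ f, S f → ℤ))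
      LinearMap.inl_injective (LinearMap.range P.coboundary)).finrank_eq
    rw [e1] at e2
    exact e3.trans e2.symm
  rw [hrk, Submodule.finrank_quotient_add_finrank]

/-- The Euler characteristic in terms of the punctured realization. -/
theorem cohomologyRank_punctured (hS : ∀ f, ∀ s ∈ S f, ‖s‖ < 1) (hne : ∀ f, (S f).Nonempty) :
    cohomologyRank (P.punctured S) = P.eulerChar - ∑ f, ((S f).card : ℤ) := by
  have h1 := finrank_integer_maps hS
  have h2 := finrank_ker_faceDefect hne
  have h3 := P.finrank_range_coboundary
  have h4 := finrank_circle_maps hS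
  -- Rank H¹ is `(A + Σ |S f| - C) - (V - rank H⁰)`.
  unfold cohomologyRank eulerChar
  omega

end PolygonalPresentation

/-! ### Topological invariance of the Euler characteristic. -/

namespace PolygonalPresentation

variable (P : PolygonalPresentation)

/-- The image of the interior of a polygon. -/
def openCell (f : Fin P.numFaces) : Set P.Realization := P.proj f '' {z : Disk | ‖(z : ℂ)‖ < 1}

theorem isOpen_openCell (f : Fin P.numFaces) : IsOpen (P.openCell f) := by
  rw [← P.isQuotientMap_toRealization.isOpen_preimage]
  have : P.toRealization ⁻¹' P.openCell f =
      Sigma.mk f '' {z : Disk | ‖(z : ℂ)‖ < 1} := by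
    ext ⟨f', w⟩
    constructor
    · rintro ⟨z, hz, e⟩
      exact ⟨z, hz, (P.eq_of_proj_eq_of_norm_lt hz e.symm).symm⟩
    · rintro ⟨z, hz, e⟩
      rw [← e]
      exact ⟨z, hz, rfl⟩
  rw [this]
  exact isOpenMap_sigmaMk _ (isOpen_lt (by fun_prop) continuous_const)

theorem openCell_nonempty (f : Fin P.numFaces) : (P.openCell f).Nonempty :=
  ⟨_, toDisk 0, by simp [toDisk, shrink], rfl⟩

/-- Each point is a radial limit of interior points of its polygon. -/
theorem dense_iUnion_openCell : Dense (⋃ f, P.openCell f) := by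
  intro x
  obtain ⟨f, z, rfl⟩ := P.exists_proj_eq x
  refine closure_mono (Set.subset_iUnion _ f) ?_
  refine image_closure_subset_closure_image (P.continuous_proj f) ⟨z, ?_, rfl⟩
  have hz : ‖(z : ℂ)‖ ≤ 1 := mem_closedBall_zero_iff.1 z.2
  have hc : Continuous fun t : ℝ => toDisk (t * z) :=
    Continuous.subtype_mk (continuous_shrink.comp (by fun_prop)) _
  have h1 : Filter.Tendsto (fun t : ℝ => toDisk (t * z)) (nhdsWithin 1 (Set.Iio 1)) (nhds z) := by
    have := hc.tendsto 1
    simp only [Complex.ofReal_one, one_mul, toDisk_coe] at this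
    exact this.mono_left nhdsWithin_le_nhds
  refine mem_closure_of_tendsto h1 ?_
  filter_upwards [Ioo_mem_nhdsLT (zero_lt_one : (0 : ℝ) < 1)] with t ht
  have h2 : ‖(t : ℂ) * z‖ < 1 := by
    rw [norm_mul, Complex.norm_real, Real.norm_of_nonneg ht.1.le]
    nlinarith [ht.1, ht.2, norm_nonneg (z : ℂ)]
  show ‖((toDisk (t * z) : Disk) : ℂ)‖ < 1
  rwa [coe_toDisk (by simpa using h2.le)]

/-- Points of open cells have unique polygon coordinates, so the punctures can be given as a subset
of the space, in a form that a homeomorphism transports. -/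
theorem cohomologyRank_compl (T : Finset P.Realization) (hT : ∀ x ∈ T, ∃ f, x ∈ P.openCell f)
    (hT' : ∀ f, ∃ x ∈ T, x ∈ P.openCell f) :
    cohomologyRank {x // x ∉ T} = P.eulerChar - T.card := by
  classical
  have hc : ∀ x : P.Realization, ∃ c : Σ _ : Fin P.numFaces, Disk,
      x ∈ T → ‖(c.2 : ℂ)‖ < 1 ∧ P.proj c.1 c.2 = x := by
    intro x
    by_cases hx : x ∈ T
    · obtain ⟨f, z, hz, e⟩ := hT x hx
      exact ⟨⟨f, z⟩, fun _ => ⟨hz, e⟩⟩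
    · obtain ⟨f, z, e⟩ := P.exists_proj_eq x
      exact ⟨⟨f, z⟩, fun h => absurd h hx⟩
  choose c hc using hc
  let S : Fin P.numFaces → Finset ℂ := fun f =>
    (T.filter fun x => (c x).1 = f).image fun x => ((c x).2 : ℂ)
  have hmem : ∀ f s, s ∈ S f ↔ ∃ x ∈ T, (c x).1 = f ∧ ((c x).2 : ℂ) = s := by
    intro f s; simp [S, and_assoc]
  have hS : ∀ f, ∀ s ∈ S f, ‖s‖ < 1 := by
    intro f s hs
    obtain ⟨x, hx, -, rfl⟩ := (hmem f s).1 hs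
    exact (hc x hx).1
  have hne : ∀ f, (S f).Nonempty := by
    intro f
    obtain ⟨x, hx, z, hz, e⟩ := hT' f
    have e' := P.eq_of_proj_eq_of_norm_lt hz ((hc x hx).2.trans e.symm)
    exact ⟨_, (hmem f _).2 ⟨x, hx, congrArg Sigma.fst e', rfl⟩⟩
  have hcard : ∑ f, (S f).card = T.card := by
    rw [Finset.card_eq_sum_card_fiberwise (f := fun x => (c x).1) (t := Finset.univ) (by simp)]
    refine Finset.sum_congr rfl fun f _ => Finset.card_image_of_injOn ?_
    intro x hx y hy e
    simp only [Finset.coe_filter, Set.mem_ofPred_eq] at hx hy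
    have e' : c x = c y := Sigma.ext (hx.2.trans hy.2.symm) (heq_of_eq (Subtype.ext e))
    rw [← (hc x hx.1).2, ← (hc y hy.1).2, e']
  have hset : ∀ x, x ∉ T ↔ x ∈ P.punctured S := by
    intro x
    constructor
    · rintro hx f z hz rfl
      obtain ⟨y, hy, rfl, e⟩ := (hmem f z).1 hz
      refine hx ?_
      rw [← Subtype.ext e, (hc y hy).2]
      exact hy
    · intro h hx
      exact h (c x).1 (c x).2 ((hmem _ _).2 ⟨x, hx, rfl, rfl⟩) (hc x hx).2.symm
  have h1 := cohomologyRank_punctured hS hne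
  rw [← hcard]
  push_cast
  rw [← h1]
  exact ((Homeomorph.refl P.Realization).subtype hset).cohomologyRank_eq

/-- The Euler characteristic is a topological invariant. -/
theorem eulerChar_eq_of_homeomorph {P Q : PolygonalPresentation}
    (h : P.Realization ≃ₜ Q.Realization) : P.eulerChar = Q.eulerChar := by
  classical
  have hQ : Dense (h ⁻¹' ⋃ g, Q.openCell g) := Q.dense_iUnion_openCell.preimage h.isOpenMap
  have h1 : ∀ f, ∃ x, x ∈ P.openCell f ∧ ∃ g, h x ∈ Q.openCell g := by
    intro f
    obtain ⟨x, hx, hx'⟩ := hQ.inter_open_nonempty _ (P.isOpen_openCell f) (P.openCell_nonempty f)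
    exact ⟨x, hx, by simpa using hx'⟩
  have h2 : ∀ g, ∃ x, (∃ f, x ∈ P.openCell f) ∧ h x ∈ Q.openCell g := by
    intro g
    obtain ⟨y, hy⟩ := Q.openCell_nonempty g
    obtain ⟨x, hx, hx'⟩ := P.dense_iUnion_openCell.inter_open_nonempty _
      ((Q.isOpen_openCell g).preimage h.continuous) ⟨h.symm y, by simpa using hy⟩
    exact ⟨x, by simpa using hx', hx⟩
  choose a ha ha' using h1
  choose b hb hb' using h2
  -- Every point of `T` is interior for both presentations; `a` hits every cell of `P`, and `b`
  -- every cell of `Q`.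
  let T : Finset P.Realization := Finset.univ.image a ∪ Finset.univ.image b
  have e1 := P.cohomologyRank_compl T (by
    intro x hx
    rcases Finset.mem_union.1 hx with hx | hx
    · obtain ⟨f, -, rfl⟩ := Finset.mem_image.1 hx
      exact ⟨f, ha f⟩
    · obtain ⟨g, -, rfl⟩ := Finset.mem_image.1 hx
      exact hb g) (fun f => ⟨a f, by simp [T], ha f⟩)
  have e2 := Q.cohomologyRank_compl (T.map h.toEquiv.toEmbedding) (by
    intro y hy
    obtain ⟨x, hx, rfl⟩ := Finset.mem_map.1 hy
    rcases Finset.mem_union.1 hx with hx | hx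
    · obtain ⟨f, -, rfl⟩ := Finset.mem_image.1 hx
      exact ha' f
    · obtain ⟨g, -, rfl⟩ := Finset.mem_image.1 hx
      exact ⟨g, hb' g⟩)
    (fun g => ⟨h (b g), Finset.mem_map.2 ⟨b g, by simp [T], rfl⟩, hb' g⟩)
  have e3 : cohomologyRank {x // x ∉ T} =
      cohomologyRank {y // y ∉ T.map h.toEquiv.toEmbedding} := by
    refine Homeomorph.cohomologyRank_eq (h.subtype fun x => not_congr ?_)
    rw [Finset.mem_map]
    exact ⟨fun hx => ⟨x, hx, rfl⟩, fun ⟨x', hx', e⟩ => h.injective e ▸ hx'⟩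
  rw [Finset.card_map] at e2
  linarith

end PolygonalPresentation

/-! ### Disjoint boundary arcs as sides of a polygon. -/

theorem circ_eq_of_turn_eq {z : ℂ} (hz : ‖z‖ = 1) {x : ℝ} (h : turn z = x) : circ x = z := by
  obtain ⟨y, -, rfl⟩ := exists_circ_eq hz
  rw [turn_circ] at h
  exact circ_eq_circ_iff.2 (UnitAddCircle.coe_eq_coe_iff_int.1 h.symm)

/-- An embedded arc on the circle has an increasing angle function, after reversing it if needed. -/
theorem exists_angle_of_arc {α : unitInterval → ℂ} (hc : Continuous α) (hn : ∀ t, ‖α t‖ = 1)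
    (hinj : Function.Injective α) :
    ∃ (o : Bool) (a : unitInterval → ℝ), Continuous a ∧ StrictMono a ∧ a 1 < a 0 + 1 ∧
      ∀ t, α t = circ (a (if o then t else unitInterval.symm t)) := by
  have hne : ∀ t, α t ≠ 0 := fun t h => by simpa [h] using hn t
  obtain ⟨g, hg, hg'⟩ := exists_real_lift_of_convex (convex_univ (E := ℝ))
    (φ := fun x => turn (α (Set.projIcc 0 1 zero_le_one x)))
    (continuous_iff_continuousAt.2 fun x => (continuousAt_turn (hne _)).comp
      (f := fun x => α (Set.projIcc 0 1 zero_le_one x))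
      (hc.comp continuous_projIcc).continuousAt).continuousOn
  have hgc : Continuous fun t : unitInterval => g t :=
    (continuousOn_univ.1 hg).comp continuous_subtype_val
  have hgα : ∀ t : unitInterval, circ (g t) = α t := fun t =>
    circ_eq_of_turn_eq (hn t) (by rw [← hg' t trivial, Set.projIcc_val])
  have hginj : Function.Injective fun t : unitInterval => g t := fun t t' h => by
    apply hinj; rw [← hgα, ← hgα]; exact congrArg circ h
  obtain ⟨o, a, ha, ha', h⟩ : ∃ (o : Bool) (a : unitInterval → ℝ), Continuous a ∧ StrictMono a ∧
      ∀ t, α t = circ (a (if o then t else unitInterval.symm t)) := by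
    rcases hgc.strictMono_of_inj_boundedOrder' hginj with h | h
    · exact ⟨true, _, hgc, h, fun t => by simp [hgα]⟩
    · refine ⟨false, fun t => g (unitInterval.symm t), hgc.comp unitInterval.continuous_symm,
        fun t t' ht => h (unitInterval.strictAnti_symm ht), fun t => ?_⟩
      simp only [Bool.false_eq_true, if_false]
      rw [unitInterval.symm_symm, hgα]
  -- If the angle grew by a full turn or more, the arc would return to its starting point.
  refine ⟨o, a, ha, ha', ?_, h⟩
  by_contra! hlt
  obtain ⟨t, -, ht⟩ := intermediate_value_Icc (zero_le_one' unitInterval) ha.continuousOn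
    (⟨by linarith, hlt⟩ : a 0 + 1 ∈ Set.Icc (a 0) (a 1))
  have h1 : circ (a t) = circ (a 0) := circ_eq_circ_iff.2 ⟨1, by simp [ht]⟩
  have h2 : t = 0 := by
    have key : ∀ s s', circ (a s) = circ (a s') → s = s' := by
      intro s s' e
      have e' : ∀ s, circ (a s) = α (if o then s else unitInterval.symm s) := by
        intro s; rw [h]; cases o <;> simp
      rw [e', e'] at e
      have := hinj e
      cases o <;> simpa using this
    exact key _ _ h1
  rw [h2] at ht
  linarith

/-- Cyclic subdivision of the circle in which finitely many disjoint arcs are segments. -/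
theorem exists_subdivision {K : Type*} [Finite K] (a : K → unitInterval → ℝ) (x₀ : ℝ)
    (hc : ∀ k, Continuous (a k)) (hm : ∀ k, StrictMono (a k))
    (h0 : ∀ k, x₀ ≤ a k 0) (h1 : ∀ k, a k 1 < x₀ + 1)
    (hinj : ∀ k k' t t', a k t = a k' t' → k = k') :
    ∃ (N : ℕ) (_ : NeZero N) (τ : ℕ → ℝ) (β : Fin N → unitInterval → ℝ) (side : K → Fin N),
      τ 0 = x₀ ∧ τ N = x₀ + 1 ∧ (∀ i j, i < j → j ≤ N → τ i < τ j) ∧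
      (∀ j, Continuous (β j)) ∧ (∀ j, StrictMono (β j)) ∧ (∀ j, β j 0 = τ j) ∧
      (∀ j, β j 1 = τ (j + 1)) ∧ ∀ k, β (side k) = a k := by
  classical
  have := Fintype.ofFinite K
  -- The breakpoints are the base point and all ends of arcs; `τ` lists them in order and ends with
  -- `x₀ + 1`.
  let T : Finset ℝ := insert x₀ (Finset.univ.image (fun k => a k 0) ∪
    Finset.univ.image fun k => a k 1)
  have hT : ∀ x, x ∈ T ↔ x = x₀ ∨ (∃ k, a k 0 = x) ∨ ∃ k, a k 1 = x := by simp [T]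
  have ha01 : ∀ k, a k 0 < a k 1 := fun k => hm k zero_lt_one
  have hTmem : ∀ x ∈ T, x₀ ≤ x ∧ x < x₀ + 1 := by
    intro x hx
    rcases (hT x).1 hx with rfl | ⟨k, rfl⟩ | ⟨k, rfl⟩
    · exact ⟨le_rfl, by linarith⟩
    · exact ⟨h0 k, (ha01 k).trans (h1 k)⟩
    · exact ⟨(h0 k).trans (ha01 k).le, h1 k⟩
  let N := T.card
  have hNpos : 0 < N := Finset.card_pos.2 ⟨x₀, by simp [T]⟩
  let em : Fin N ↪o ℝ := T.orderEmbOfFin rfl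
  have hem : ∀ x, x ∈ T ↔ ∃ j, em j = x := fun x => by
    rw [← Finset.mem_coe, ← Finset.range_orderEmbOfFin T rfl]; rfl
  let τ : ℕ → ℝ := fun i => if h : i < N then em ⟨i, h⟩ else x₀ + 1
  have hτ : ∀ j : Fin N, τ j = em j := fun j => dif_pos j.2
  have hτN : τ N = x₀ + 1 := dif_neg (lt_irrefl N)
  have hτmono : ∀ i j, i < j → j ≤ N → τ i < τ j := by
    intro i j hij hj
    have hi : i < N := hij.trans_le hj
    rcases hj.lt_or_eq with hj | rfl
    · rw [hτ ⟨i, hi⟩, hτ ⟨j, hj⟩]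
      exact em.strictMono hij
    · rw [hτN, hτ ⟨i, hi⟩]
      exact (hTmem _ ((hem _).2 ⟨_, rfl⟩)).2
  have hτ0 : τ 0 = x₀ := by
    obtain ⟨j, hj⟩ := (hem x₀).1 (by simp [T])
    refine le_antisymm ?_ (hTmem _ ((hem _).2 ⟨⟨0, hNpos⟩, (hτ ⟨0, hNpos⟩).symm⟩)).1
    rw [← hj, hτ ⟨0, hNpos⟩]
    exact em.monotone (Fin.mk_le_of_le_val (Nat.zero_le _))
  have hside : ∀ k, ∃ j : Fin N, em j = a k 0 := fun k =>
    (hem _).1 ((hT _).2 (Or.inr (Or.inl ⟨k, rfl⟩)))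
  choose side hside using hside
  -- A breakpoint strictly inside arc `k` would be the end of another arc, against disjointness, or
  -- `x₀`, which lies below.
  have hnext : ∀ k, τ (side k + 1) = a k 1 := by
    intro k
    obtain ⟨i, hi⟩ := (hem (a k 1)).1 ((hT _).2 (Or.inr (Or.inr ⟨k, rfl⟩)))
    have hlt : side k < i := by rw [← em.lt_iff_lt, hside, hi]; exact ha01 k
    rcases (Nat.succ_le_of_lt (show (side k : ℕ) < i from hlt)).lt_or_eq with h | h
    · exfalso
      have hj : (side k : ℕ) + 1 < N := h.trans i.2
      have hx1 : a k 0 < em ⟨_, hj⟩ := by rw [← hside]; exact em.strictMono (Nat.lt_succ_self _)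
      have hx2 : em ⟨_, hj⟩ < a k 1 := by rw [← hi]; exact em.strictMono h
      obtain ⟨t, -, ht⟩ := intermediate_value_Icc (zero_le_one' unitInterval) (hc k).continuousOn
        ⟨hx1.le, hx2.le⟩
      rcases (hT _).1 ((hem _).2 ⟨⟨_, hj⟩, rfl⟩) with h' | ⟨k', h'⟩ | ⟨k', h'⟩
      · rw [h'] at hx1
        exact absurd (h0 k) (not_le.2 hx1)
      · obtain rfl := hinj k' k 0 t (h'.trans ht.symm)
        exact hx1.ne h'
      · obtain rfl := hinj k' k 1 t (h'.trans ht.symm)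
        exact hx2.ne' h'
    · have e : (side k : ℕ) + 1 = i := h
      rw [e, hτ, hi]
  have hβ : ∀ j : Fin N, ∃ β : unitInterval → ℝ, Continuous β ∧ StrictMono β ∧ β 0 = τ j ∧
      β 1 = τ (j + 1) ∧ ∀ k, side k = j → β = a k := by
    intro j
    by_cases hj : ∃ k, side k = j
    · obtain ⟨k, rfl⟩ := hj
      refine ⟨a k, hc k, hm k, by rw [hτ, hside], (hnext k).symm, fun k' hk' => ?_⟩
      rw [hinj k k' 0 0 (by rw [← hside, ← hside, hk'])]
    · have hlt := hτmono j (j + 1) (Nat.lt_succ_self _) j.2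
      refine ⟨fun t => τ j + t * (τ (j + 1) - τ j), by fun_prop, fun t t' ht => ?_, by simp,
        by simp, fun k hk => absurd ⟨k, hk⟩ hj⟩
      have : (t : ℝ) < t' := ht
      have := mul_lt_mul_of_pos_right this (sub_pos.2 hlt)
      simpa using this
  choose β b1 b2 b3 b4 b5 using hβ
  exact ⟨N, ⟨hNpos.ne'⟩, τ, β, side, hτ0, hτN, hτmono, b1, b2, b3, b4, fun k => b5 _ k rfl⟩

/-- The circle map that is given by a cyclic subdivision is bijective. -/
theorem exists_bijective_circle_map {N : ℕ} [NeZero N] {τ : ℕ → ℝ} {β : Fin N → unitInterval → ℝ}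
    (hτ1 : τ N = τ 0 + 1) (hτ : ∀ i j, i < j → j ≤ N → τ i < τ j)
    (hc : ∀ j, Continuous (β j)) (hm : ∀ j, StrictMono (β j)) (h0 : ∀ j, β j 0 = τ j)
    (h1 : ∀ j, β j 1 = τ (j + 1)) :
    ∃ c : C(Metric.sphere (0 : ℂ) 1, Metric.sphere (0 : ℂ) 1), Function.Bijective c ∧
      ∀ (j : Fin N) (t : unitInterval),
        c ⟨circ (((j : ℕ) + (t : ℝ)) / N), circ_mem_sphere _⟩ = ⟨circ (β j t), circ_mem_sphere _⟩ := by
  have hN : (N : ℝ) ≠ 0 := NeZero.ne _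
  obtain ⟨c, hcc⟩ := exists_circle_map
    (fun j t => (⟨circ (β j t), circ_mem_sphere _⟩ : Metric.sphere (0 : ℂ) 1))
    (fun j => Continuous.subtype_mk (continuous_circ.comp (hc j)) _) (fun j => by
      refine Subtype.ext (circ_eq_circ_iff.2 ?_)
      rw [h0, h1, Fin.val_add, Fin.val_one', Nat.add_mod_mod]
      rcases (Nat.succ_le_of_lt j.2).lt_or_eq with h | h
      · exact ⟨0, by rw [Nat.mod_eq_of_lt h]; simp⟩
      · have e : (j : ℕ) + 1 = N := h
        exact ⟨1, by rw [e, Nat.mod_self, hτ1]; simp⟩)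
  have hτle : ∀ i j, i ≤ j → j ≤ N → τ i ≤ τ j := fun i j hij hj => by
    rcases hij.lt_or_eq with h | rfl
    · exact (hτ i j h hj).le
    · exact le_rfl
  have hlo : ∀ (j : Fin N) t, τ j ≤ β j t := fun j t => by
    rw [← h0]; exact (hm j).monotone (unitInterval.nonneg t)
  have hhi : ∀ (j : Fin N) t, β j t ≤ τ (j + 1) := fun j t => by
    rw [← h1]; exact (hm j).monotone (unitInterval.le_one t)
  have hlo' : ∀ (j : Fin N) t, τ 0 ≤ β j t := fun j t => (hτle 0 j (Nat.zero_le _) j.2.le).trans (hlo j t)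
  have hhi' : ∀ (j : Fin N) t, β j t ≤ τ 0 + 1 := fun j t =>
    (hhi j t).trans (hτ1 ▸ hτle (j + 1) N j.2 le_rfl)
  have hτinj : ∀ i j, i ≤ N → j ≤ N → τ i = τ j → i = j := by
    intro i j hi hj e
    rcases lt_trichotomy i j with h | h | h
    · exact absurd e (hτ i j h hj).ne
    · exact h
    · exact absurd e (hτ j i h hi).ne'
  -- Equal angles on different sides occur only at the common end of consecutive sides; `eq2` treats
  -- the last and the first side.
  have eq1 : ∀ (j j' : Fin N) (s s' : unitInterval), j < j' → β j s = β j' s' →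
      circ (((j : ℕ) + (s : ℝ)) / N) = circ (((j' : ℕ) + (s' : ℝ)) / N) := by
    intro j j' s s' hj e
    have hj' : (j : ℕ) + 1 ≤ j' := hj
    have a1 := hhi j s
    have a2 := hτle (j + 1) j' hj' j'.2.le
    have a3 := hlo j' s'
    have b1 : β j s = β j 1 := by rw [h1]; linarith
    have b2 : β j' s' = β j' 0 := by rw [h0]; linarith
    have b3 : (j : ℕ) + 1 = j' := hτinj _ _ j.2 j'.2.le (by linarith)
    rw [(hm j).injective b1, (hm j').injective b2, ← b3]
    simp
  have eq2 : ∀ (j j' : Fin N) (s s' : unitInterval), β j s = β j' s' + 1 →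
      circ (((j : ℕ) + (s : ℝ)) / N) = circ (((j' : ℕ) + (s' : ℝ)) / N) := by
    intro j j' s s' e
    have a1 := hhi' j s
    have a2 := hlo' j' s'
    have a3 := hhi j s
    have a4 := hτ1 ▸ hτle (j + 1) N j.2 le_rfl
    have a5 := hlo j' s'
    have a6 := hτle 0 j' (Nat.zero_le _) j'.2.le
    have b1 : β j s = β j 1 := by rw [h1]; linarith
    have b2 : β j' s' = β j' 0 := by rw [h0]; linarith
    have b3 : (j : ℕ) + 1 = N := hτinj _ _ j.2 le_rfl (by linarith)
    have b4 : (j' : ℕ) = 0 := hτinj _ _ j'.2.le (Nat.zero_le _) (by linarith)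
    have b5 : ((j : ℕ) : ℝ) + 1 = N := by exact_mod_cast b3
    rw [(hm j).injective b1, (hm j').injective b2, b4]
    simp [b5, hN, circ_one, circ_zero]
  refine ⟨c, ⟨?_, ?_⟩, hcc⟩
  · rintro ⟨z, hz⟩ ⟨z', hz'⟩ e
    obtain ⟨j, s, rfl⟩ := exists_side_eq N (z := z) (by simpa using hz)
    obtain ⟨j', s', rfl⟩ := exists_side_eq N (z := z') (by simpa using hz')
    apply Subtype.ext
    show circ _ = circ _
    rw [hcc, hcc] at e
    obtain ⟨n, hn⟩ := circ_eq_circ_iff.1 (congrArg Subtype.val e)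
    have c1 : (n : ℝ) ≤ (1 : ℤ) := by push_cast; linarith [hhi' j s, hlo' j' s']
    have c2 : ((-1 : ℤ) : ℝ) ≤ n := by push_cast; linarith [hhi' j' s', hlo' j s]
    have c1' : n ≤ 1 := by exact_mod_cast c1
    have c2' : -1 ≤ n := by exact_mod_cast c2
    interval_cases n
    · exact (eq2 j' j s' s (by push_cast at hn; linarith)).symm
    · simp only [Int.cast_zero, add_zero] at hn
      rcases lt_trichotomy j j' with h | rfl | h
      · exact eq1 _ _ _ _ h hn
      · rw [(hm j).injective hn]
      · exact (eq1 _ _ _ _ h hn.symm).symm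
    · exact eq2 j j' s s' (by push_cast at hn; linarith)
  · rintro ⟨z, hz⟩
    obtain ⟨x, -, rfl⟩ := exists_circ_eq (z := z) (by simpa using hz)
    -- The representative of the angle within one turn after `τ 0`.
    let y := τ 0 + Int.fract (x - τ 0)
    have hy : circ x = circ y :=
      circ_eq_circ_iff.2 ⟨⌊x - τ 0⌋, by simp only [y, Int.fract]; ring⟩
    have hy0 : τ 0 ≤ y := le_add_of_nonneg_right (Int.fract_nonneg _)
    have hy1 : y < τ N := by rw [hτ1]; exact add_lt_add_right (Int.fract_lt_one _) _
    have key : ∀ i, i ≤ N → y < τ i → ∃ j : Fin N, τ j ≤ y ∧ y < τ (j + 1) := by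
      intro i
      induction i with
      | zero => intro _ h; exact absurd hy0 (not_le.2 h)
      | succ i ih =>
        intro hi h
        rcases lt_or_ge y (τ i) with h' | h'
        · exact ih (Nat.le_of_succ_le hi) h'
        · exact ⟨⟨i, hi⟩, h', h⟩
    obtain ⟨j, hj, hj'⟩ := key N le_rfl hy1
    obtain ⟨t, -, ht⟩ := intermediate_value_Icc (zero_le_one' unitInterval) (hc j).continuousOn
      (⟨by rwa [h0], by rw [h1]; exact hj'.le⟩ : y ∈ Set.Icc (β j 0) (β j 1))
    refine ⟨_, (hcc j t).trans (Subtype.ext ?_)⟩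
    show circ _ = circ x
    rw [ht, hy]

/-- A homeomorphism of the circle extends to the disk. -/
theorem exists_disk_extension {c : C(Metric.sphere (0 : ℂ) 1, Metric.sphere (0 : ℂ) 1)}
    (hc : Function.Bijective c) : ∃ C : Disk → Disk, Continuous C ∧ Function.Bijective C ∧
      ∀ z : Metric.sphere (0 : ℂ) 1, (C ⟨z, Metric.sphere_subset_closedBall z.2⟩ : ℂ) = c z := by
  classical
  have hr : ∀ z : ℂ, z ≠ 0 → z / ‖z‖ ∈ Metric.sphere (0 : ℂ) 1 := fun z hz => by
    simp [hz]
  let g : ℂ → ℂ := fun z => if h : z ≠ 0 then c ⟨z / ‖z‖, hr z h⟩ else 0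
  have hg : ∀ z (h : z ≠ 0), g z = c ⟨z / ‖z‖, hr z h⟩ := fun z h => dif_pos h
  have hg1 : ∀ z, z ≠ 0 → ‖g z‖ = 1 := fun z h => by
    rw [hg z h]; exact mem_sphere_zero_iff_norm.1 (c _).2
  have hgc : ContinuousOn g {0}ᶜ := by
    rw [continuousOn_iff_continuous_domRestrict]
    have : Continuous fun z : ({0}ᶜ : Set ℂ) => ((c ⟨(z : ℂ) / ‖(z : ℂ)‖, hr z z.2⟩ : _) : ℂ) := by
      refine continuous_subtype_val.comp (c.continuous.comp (Continuous.subtype_mk ?_ _))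
      refine Continuous.div continuous_subtype_val (by fun_prop) fun z => ?_
      exact Complex.ofReal_ne_zero.2 (norm_ne_zero_iff.2 z.2)
    convert this using 2 with z
    exact hg z z.2
  -- The cone over `c`; norm preservation gives continuity at 0.
  let f : ℂ → ℂ := fun z => ‖z‖ * g z
  have hf1 : ∀ z, ‖f z‖ = ‖z‖ := by
    intro z
    by_cases hz : z = 0
    · simp [f, hz]
    · simp [f, hg1 z hz]
  have hfc : Continuous f := by
    rw [continuous_iff_continuousAt]
    intro z
    by_cases hz : z = 0
    · subst hz
      rw [ContinuousAt, show f 0 = 0 by simp [f], tendsto_zero_iff_norm_tendsto_zero]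
      simp only [hf1]
      simpa using (continuous_norm (E := ℂ)).tendsto 0
    · exact ContinuousAt.mul (by fun_prop) (hgc.continuousAt (isOpen_ne.mem_nhds hz))
  have hmem : ∀ z : Disk, f z ∈ Metric.closedBall (0 : ℂ) 1 := fun z => by
    rw [mem_closedBall_zero_iff, hf1]; exact mem_closedBall_zero_iff.1 z.2
  refine ⟨fun z => ⟨f z, hmem z⟩, Continuous.subtype_mk (by fun_prop) _, ⟨?_, ?_⟩, ?_⟩
  · rintro ⟨z, hz⟩ ⟨w, hw⟩ e
    have e' : f z = f w := congrArg Subtype.val e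
    have hn : ‖z‖ = ‖w‖ := by rw [← hf1, e', hf1]
    apply Subtype.ext
    show z = w
    by_cases h0 : z = 0
    · rw [h0, norm_zero] at hn
      rw [h0, norm_eq_zero.1 hn.symm]
    · have h0' : w ≠ 0 := by rw [← norm_ne_zero_iff, ← hn, norm_ne_zero_iff]; exact h0
      have hnz : (‖z‖ : ℂ) ≠ 0 := by simpa using h0
      simp only [f, hg z h0, hg w h0', ← hn] at e'
      have h1 := congrArg Subtype.val (hc.1 (Subtype.ext (mul_left_cancel₀ hnz e')))
      exact (div_left_inj' hnz).1 h1
  · rintro ⟨w, hw⟩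
    by_cases h0 : w = 0
    · exact ⟨⟨0, by simp⟩, Subtype.ext (by simp [f, h0])⟩
    · obtain ⟨y, hy⟩ := hc.2 ⟨w / ‖w‖, hr w h0⟩
      have hy1 : ‖(y : ℂ)‖ = 1 := mem_sphere_zero_iff_norm.1 y.2
      have hnw : (‖w‖ : ℂ) ≠ 0 := by simpa using h0
      have hy0 : (y : ℂ) ≠ 0 := by rw [← norm_ne_zero_iff, hy1]; norm_num
      have hn : ‖(‖w‖ : ℂ) * y‖ = ‖w‖ := by simp [hy1]
      refine ⟨⟨‖w‖ * y, by rw [mem_closedBall_zero_iff, hn]; exact mem_closedBall_zero_iff.1 hw⟩,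
        Subtype.ext ?_⟩
      simp only [f]
      rw [hg _ (mul_ne_zero hnw hy0)]
      have : (⟨(‖w‖ : ℂ) * y / ‖(‖w‖ : ℂ) * y‖, hr _ (mul_ne_zero hnw hy0)⟩ :
          Metric.sphere (0 : ℂ) 1) = y := Subtype.ext (by
        simp only [hn]; rw [mul_div_cancel_left₀ _ hnw])
      rw [this, hy, hn]
      simp only
      rw [mul_div_cancel₀ _ hnw]
  · intro z
    have hz1 : ‖(z : ℂ)‖ = 1 := mem_sphere_zero_iff_norm.1 z.2
    have hz0 : (z : ℂ) ≠ 0 := by rw [← norm_ne_zero_iff, hz1]; norm_num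
    show f z = c z
    simp [f, hg _ hz0, hz1]

/-- The point of a side of the polygon with `N` sides. -/
noncomputable def polygonPoint (N : ℕ) (j : Fin N) (o : Bool) (t : unitInterval) : Disk :=
  PolygonalPresentation.circlePoint (((j : ℕ) + (if o then (t : ℝ) else 1 - (t : ℝ))) / (N : ℝ))

theorem coe_polygonPoint (N : ℕ) (j : Fin N) (o : Bool) (t : unitInterval) :
    (polygonPoint N j o t : ℂ) =
      circ (((j : ℕ) + ((if o then t else unitInterval.symm t : unitInterval) : ℝ)) / N) := by
  cases o <;> rfl

/-- Disjoint arcs on the boundary of a disk are sides of some polygonal parametrization. -/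
theorem exists_polygon_parametrization {K : Type*} [Finite K] (α : K → unitInterval → Disk)
    (hc : ∀ k, Continuous (α k)) (hn : ∀ k t, ‖(α k t : ℂ)‖ = 1)
    (hinj : ∀ k k' t t', α k t = α k' t' → k = k' ∧ t = t') :
    ∃ (N : ℕ) (_ : NeZero N) (C : Disk → Disk) (side : K → Fin N) (o : K → Bool),
      Continuous C ∧ Function.Bijective C ∧
        ∀ k t, C (polygonPoint N (side k) (o k) t) = α k t := by
  have h1 := fun k => exists_angle_of_arc (α := fun t => (α k t : ℂ))
    (continuous_subtype_val.comp (hc k)) (hn k)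
    (fun t t' e => (hinj k k t t' (Subtype.ext e)).2)
  choose o a ac am a1 hα using h1
  have hα' : ∀ k t, circ (a k t) = α k (if o k then t else unitInterval.symm t) := by
    intro k t
    rw [hα]
    cases o k <;> simp
  have hcirc : ∀ k k' t t', circ (a k t) = circ (a k' t') → k = k' := by
    intro k k' t t' e
    rw [hα', hα'] at e
    exact (hinj _ _ _ _ (Subtype.ext e)).1
  obtain ⟨x₀, b, hb, hb0, hb1⟩ : ∃ (x₀ : ℝ) (b : K → unitInterval → ℝ),
      (∀ k, ∃ n : ℤ, ∀ t, b k t = a k t + n) ∧ (∀ k, x₀ ≤ b k 0) ∧ ∀ k, b k 1 < x₀ + 1 := by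
    rcases isEmpty_or_nonempty K with hK | ⟨⟨k₀⟩⟩
    · exact ⟨0, a, fun k => hK.elim k, fun k => hK.elim k, fun k => hK.elim k⟩
    -- Cut the circle at the start of `k₀` and shift every arc to start within one turn of it. An
    -- arc reaching `x₀ + 1` would meet arc `k₀`.
    · refine ⟨a k₀ 0, fun k t => a k t + (-⌊a k 0 - a k₀ 0⌋ : ℤ), fun k => ⟨_, fun t => rfl⟩,
        fun k => ?_, fun k => ?_⟩
      · have := Int.floor_le (a k 0 - a k₀ 0)
        push_cast; linarith
      · by_cases hk : k = k₀
        · subst hk; simpa using a1 k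
        by_contra! hlt
        have hfl := Int.lt_floor_add_one (a k 0 - a k₀ 0)
        obtain ⟨t, -, ht⟩ := intermediate_value_Icc (zero_le_one' unitInterval)
          ((ac k).add continuous_const).continuousOn
          (⟨by push_cast; linarith, hlt⟩ : a k₀ 0 + 1 ∈
            Set.Icc (a k 0 + ((-⌊a k 0 - a k₀ 0⌋ : ℤ) : ℝ)) (a k 1 + ((-⌊a k 0 - a k₀ 0⌋ : ℤ) : ℝ)))
        refine hk (hcirc k k₀ t 0 (circ_eq_circ_iff.2 ⟨1 + ⌊a k 0 - a k₀ 0⌋, ?_⟩))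
        simp only [Pi.add_apply] at ht
        push_cast at ht ⊢; linarith
  have hbc : ∀ k t, circ (b k t) = circ (a k t) := fun k t => by
    obtain ⟨n, hn⟩ := hb k
    exact circ_eq_circ_iff.2 ⟨n, hn t⟩
  obtain ⟨N, hN, τ, β, side, τ0, τN, τm, βc, βm, β0, β1, hside⟩ := exists_subdivision b x₀
    (fun k => by
      obtain ⟨n, hn⟩ := hb k
      rw [funext hn]; exact (ac k).add continuous_const)
    (fun k t t' h => by
      obtain ⟨n, hn⟩ := hb k
      rw [hn, hn]; exact add_lt_add_left (am k h) _)
    hb0 hb1 (fun k k' t t' e => hcirc k k' t t' (by rw [← hbc, ← hbc, e]))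
  obtain ⟨c, hcb, hcc⟩ := exists_bijective_circle_map (by rw [τN, τ0]) τm βc βm β0 β1
  obtain ⟨C, hC, hCb, hCc⟩ := exists_disk_extension hcb
  refine ⟨N, hN, C, side, o, hC, hCb, fun k t => Subtype.ext ?_⟩
  have e1 : polygonPoint N (side k) (o k) t = ⟨_, Metric.sphere_subset_closedBall (circ_mem_sphere
      (((side k : ℕ) + ((if o k then t else unitInterval.symm t : unitInterval) : ℝ)) / N))⟩ :=
    Subtype.ext (coe_polygonPoint _ _ _ _)
  rw [e1]
  refine (hCc ⟨_, circ_mem_sphere _⟩).trans ?_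
  rw [hcc, hside]
  show circ _ = _
  rw [hbc, hα']
  cases o k <;> simp

/-! ### Gluing polygons along sides and counting cells. -/

/-- Counting a quotient that identifies the points `w i` with the points `w' i`. -/
theorem Nat.card_quot_add_card {α ι : Type*} [Finite α] {R : α → α → Prop}
    {w w' : ι → α} (hw : Function.Injective w) (hw' : ∀ i i', w' i ≠ w i')
    (hR : ∀ i, R (w i) (w' i))
    (h : ∀ a b, R a b → a = b ∨ ∃ i, (a = w i ∧ b = w' i) ∨ (a = w' i ∧ b = w i)) :
    Nat.card (Quot R) + Nat.card ι = Nat.card α := by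
  classical
  have : Finite ι := Finite.of_injective w hw
  -- `ρ` picks representatives: each `w i` is replaced by `w' i`, so the classes correspond to the
  -- complement of the range of `w`.
  let ρ : α → α := Function.extend w w' id
  have hρw : ∀ i, ρ (w i) = w' i := fun i => hw.extend_apply _ _ i
  have hρ : ∀ a, (∀ i, w i ≠ a) → ρ a = a := fun a ha =>
    Function.extend_apply' _ _ _ (fun ⟨i, hi⟩ => ha i hi)
  have hρw' : ∀ i, ρ (w' i) = w' i := fun i => hρ _ fun i' e => hw' i i' e.symm
  have hnot : ∀ a i, w i ≠ ρ a := by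
    intro a i e
    by_cases ha : ∃ i, w i = a
    · obtain ⟨i', rfl⟩ := ha
      rw [hρw] at e; exact hw' _ _ e.symm
    · push Not at ha
      rw [hρ a ha] at e; exact ha i e
  let e : Quot R ≃ {a // a ∉ Set.range w} :=
    { toFun := Quot.lift (fun a => ⟨ρ a, fun ⟨i, hi⟩ => hnot a i hi⟩) (by
        intro a b hab
        apply Subtype.ext
        show ρ a = ρ b
        rcases h a b hab with rfl | ⟨i, ⟨rfl, rfl⟩ | ⟨rfl, rfl⟩⟩
        · rfl
        · rw [hρw, hρw']
        · rw [hρw, hρw'])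
      invFun := fun a => Quot.mk _ a
      left_inv := by
        intro q
        induction q using Quot.inductionOn with
        | h a =>
          show Quot.mk R (ρ a) = Quot.mk R a
          by_cases ha : ∃ i, w i = a
          · obtain ⟨i, rfl⟩ := ha
            rw [hρw]; exact (Quot.sound (hR i)).symm
          · push Not at ha
            rw [hρ a ha]
      right_inv := fun a => Subtype.ext (hρ a fun i hi => a.2 ⟨i, hi⟩) }
  rw [Nat.card_congr e, Nat.card_congr (Equiv.ofInjective w hw), add_comm]
  have := Fintype.ofFinite α
  rw [← Nat.card_sum]
  exact Nat.card_congr (Equiv.Set.sumCompl (Set.range w))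

/-- A space that is glued from polygons along disjoint pairs of sides has a polygonal
presentation. -/
theorem exists_presentation_of_gluing {Y : Type*} [TopologicalSpace Y] [T2Space Y]
    {Φ X : Type} [Finite Φ] [Finite X] (N : Φ → ℕ) [hN : ∀ i, NeZero (N i)] (ψ : Φ → Disk → Y)
    (hψ : ∀ i, Continuous (ψ i)) (hinj : ∀ i, Function.Injective (ψ i))
    (hsurj : ∀ y, ∃ i z, ψ i z = y)
    (p q : X → Σ i, Fin (N i)) (op oq : X → Bool)
    (hpq : ∀ x x', (p x).1 ≠ (q x').1)
    (hglue : ∀ x t, ψ (p x).1 (polygonPoint _ (p x).2 (op x) t) =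
      ψ (q x).1 (polygonPoint _ (q x).2 (oq x) t))
    (harc : ∀ x x' t t', ψ (q x).1 (polygonPoint _ (q x).2 (oq x) t) =
      ψ (q x').1 (polygonPoint _ (q x').2 (oq x') t') → x = x' ∧ t = t')
    (hmeet : ∀ i i' z z', i ≠ i' → ψ i z = ψ i' z' → ∃ x t,
      (i = (p x).1 ∧ z = polygonPoint _ (p x).2 (op x) t ∧
        i' = (q x).1 ∧ z' = polygonPoint _ (q x).2 (oq x) t) ∨
      (i' = (p x).1 ∧ z' = polygonPoint _ (p x).2 (op x) t ∧
        i = (q x).1 ∧ z = polygonPoint _ (q x).2 (oq x) t)) :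
    ∃ P : PolygonalPresentation, P.Presents Y ∧
      P.eulerChar = (Nat.card Φ : ℤ) - Nat.card X := by
  classical
  let Sd := Σ i, Fin (N i)
  let e := Finite.equivFin Φ
  have hpq' : ∀ x x', p x ≠ q x' := fun x x' h => hpq x x' (congrArg Sigma.fst h)
  have orient : ∃ (ori : Sd → Bool) (pr : Sd → Sd), (∀ x, ori (p x) = op x) ∧
      (∀ x, ori (q x) = oq x) ∧ (∀ x, pr (p x) = q x) ∧ (∀ x, pr (q x) = p x) ∧
      ∀ y, (∀ x, p x ≠ y) → (∀ x, q x ≠ y) → pr y = y := by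
    have key : ∀ x x' t t', ψ (p x).1 (polygonPoint _ (p x).2 (op x) t) =
        ψ (p x').1 (polygonPoint _ (p x').2 (op x') t') → x = x' ∧ t = t' := fun x x' t t' h => by
      rw [hglue, hglue] at h; exact harc _ _ _ _ h
    -- The midpoint of a side is independent of its orientation, so it shows injectivity of `p` and
    -- `q` regardless of `op` and `oq`.
    let hf : unitInterval := ⟨1 / 2, by norm_num, by norm_num⟩
    have half : ∀ (n : ℕ) (j : Fin n) (o o' : Bool),
        polygonPoint n j o hf = polygonPoint n j o' hf := fun n j o o' => by
      have : (1 : ℝ) - 1 / 2 = 1 / 2 := by norm_num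
      unfold polygonPoint
      cases o <;> cases o' <;> simp only [hf, this, Bool.false_eq_true, if_true, if_false]
    have hp : Function.Injective p := fun x x' h => (key x x' hf hf (by
      rw [half _ _ (op x) true, half _ _ (op x') true, h])).1
    have hq : Function.Injective q := fun x x' h => (harc x x' hf hf (by
      rw [half _ _ (oq x) true, half _ _ (oq x') true, h])).1
    have hpn : ∀ x, ¬ ∃ x', q x' = p x := fun x ⟨x', h⟩ => hpq' x x' h.symm
    have hqn : ∀ x, ¬ ∃ x', p x' = q x := fun x ⟨x', h⟩ => hpq' x' x h
    refine ⟨Function.extend p op (Function.extend q oq fun _ => true),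
      Function.extend p q (Function.extend q p id), fun x => hp.extend_apply _ _ x, fun x => ?_,
      fun x => hp.extend_apply _ _ x, fun x => ?_, fun y h1 h2 => ?_⟩
    · rw [Function.extend_apply' _ _ _ (hqn x), hq.extend_apply]
    · rw [Function.extend_apply' _ _ _ (hqn x), hq.extend_apply]
    · rw [Function.extend_apply' _ _ _ (fun ⟨x, h⟩ => h1 x h),
        Function.extend_apply' _ _ _ (fun ⟨x, h⟩ => h2 x h)]; rfl
  obtain ⟨ori, pr, orip, oriq, prp, prq, prn⟩ := orient
  have cases_side : ∀ y : Sd, (∃ x, y = p x) ∨ (∃ x, y = q x) ∨ pr y = y := by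
    intro y
    by_cases h1 : ∃ x, y = p x
    · exact Or.inl h1
    by_cases h2 : ∃ x, y = q x
    · exact Or.inr (Or.inl h2)
    push Not at h1 h2
    exact Or.inr (Or.inr (prn y (fun x h => h1 x h.symm) fun x h => h2 x h.symm))
  have prpr : Function.Involutive pr := by
    intro y
    rcases cases_side y with ⟨x, rfl⟩ | ⟨x, rfl⟩ | h
    · rw [prp, prq]
    · rw [prq, prp]
    · rw [h, h]
  let E₀ : (Σ f : Fin (Nat.card Φ), Fin (N (e.symm f))) → Sd := fun s => ⟨e.symm s.1, s.2⟩
  have hE₀ : Function.Bijective E₀ := by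
    constructor
    · rintro ⟨f, j⟩ ⟨f', j'⟩ h
      have h1 : f = f' := e.symm.injective (congrArg Sigma.fst h)
      subst h1
      have h2 : j = j' := eq_of_heq (Sigma.mk.inj h).2
      rw [h2]
    · rintro ⟨i, j⟩
      obtain ⟨f, rfl⟩ := e.symm.surjective i
      exact ⟨⟨f, j⟩, rfl⟩
  let E := Equiv.ofBijective E₀ hE₀
  let P : PolygonalPresentation :=
    { numFaces := Nat.card Φ
      sides := fun f => N (e.symm f)
      sides_ne_zero := fun f => hN _
      orientation := fun s => ori (E s)
      pairing := fun s => E.symm (pr (E s))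
      pairing_involutive := fun s => by simp [prpr (E s)] }
  have hEpair : ∀ s : P.Side, E (P.pairing s) = pr (E s) := fun s => E.apply_symm_apply _
  let pt : Sd → unitInterval → Disk := fun y t => polygonPoint _ y.2 (ori y) t
  have hside : ∀ (s : P.Side) t, P.sidePoint s t = ⟨e (E s).1, pt (E s) t⟩ := fun s t =>
    Sigma.ext (e.apply_symm_apply s.1).symm HEq.rfl
  let Ψ : (Σ _ : Fin P.numFaces, Disk) → Y := fun x => ψ (e.symm x.1) x.2
  have hΨside : ∀ (s : P.Side) t, Ψ (P.sidePoint s t) = ψ (E s).1 (pt (E s) t) := fun s t => rfl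
  have hptp : ∀ x t, pt (p x) t = polygonPoint _ (p x).2 (op x) t := fun x t => by
    simp only [pt, orip]
  have hptq : ∀ x t, pt (q x) t = polygonPoint _ (q x).2 (oq x) t := fun x t => by
    simp only [pt, oriq]
  have hΨ : ∀ (s : P.Side) t, Ψ (P.sidePoint s t) = Ψ (P.sidePoint (P.pairing s) t) := by
    intro s t
    rw [hΨside, hΨside, hEpair]
    rcases cases_side (E s) with ⟨x, h⟩ | ⟨x, h⟩ | h
    · rw [h, prp, hptp, hptq, hglue]
    · rw [h, prq, hptp, hptq, hglue]
    · rw [h]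
  have hΨc : Continuous Ψ := continuous_sigma fun f => hψ (e.symm f)
  have hglued : ∀ x t, P.toRealization ⟨e (p x).1, polygonPoint _ (p x).2 (op x) t⟩ =
      P.toRealization ⟨e (q x).1, polygonPoint _ (q x).2 (oq x) t⟩ := by
    intro x t
    refine Quot.sound ⟨E.symm (p x), t, ?_, ?_⟩
    · rw [hside, E.apply_symm_apply, hptp]
    · rw [hside, hEpair, E.apply_symm_apply, prp, hptq]
  let Ψ' : P.Realization → Y := Quot.lift Ψ (by
    rintro _ _ ⟨s, t, rfl, rfl⟩
    exact hΨ s t)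
  have hΨ'c : Continuous Ψ' := P.isQuotientMap_toRealization.continuous_iff.2 hΨc
  have hΨ'inj : Function.Injective Ψ' := by
    intro a a' h
    obtain ⟨⟨f, z⟩, rfl⟩ := P.isQuotientMap_toRealization.surjective a
    obtain ⟨⟨f', z'⟩, rfl⟩ := P.isQuotientMap_toRealization.surjective a'
    have h' : ψ (e.symm f) z = ψ (e.symm f') z' := h
    by_cases hf : f = f'
    · subst hf
      rw [hinj _ h']
    · obtain ⟨x, t, ⟨h1, rfl, h3, rfl⟩ | ⟨h1, rfl, h3, rfl⟩⟩ :=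
        hmeet _ _ z z' (fun hh => hf (e.symm.injective hh)) h'
      · rw [Equiv.symm_apply_eq] at h1 h3
        rw [h1, h3, hglued]
      · rw [Equiv.symm_apply_eq] at h1 h3
        rw [h1, h3, hglued]
  have hΨ'surj : Function.Surjective Ψ' := by
    intro y
    obtain ⟨i, z, rfl⟩ := hsurj y
    refine ⟨P.toRealization ⟨e i, z⟩, ?_⟩
    show ψ (e.symm (e i)) z = ψ i z
    rw [e.symm_apply_apply]
  have : CompactSpace P.Realization := P.isQuotientMap_toRealization.surjective.compactSpace
    P.isQuotientMap_toRealization.continuous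
  refine ⟨P, ⟨hΨ'c.homeoOfEquivCompactToT2 (f := Equiv.ofBijective Ψ' ⟨hΨ'inj, hΨ'surj⟩)⟩, ?_⟩
  let g : Fin P.numFaces → ℂ → Y := fun f z => ψ (e.symm f) (PolygonalPresentation.toDisk z)
  have hg : ∀ (s : P.Side) t, g s.1 (P.sideCoord s t) = ψ (E s).1 (pt (E s) t) := fun s t =>
    congrArg (ψ (e.symm s.1)) (PolygonalPresentation.toDisk_coe _)
  let en : Bool → P.Side → P.Corner := fun ε s => if ε then P.source s else P.target s
  have hen : ∀ ε s, g (en ε s).1 (P.cornerCoord (en ε s)) =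
      ψ (E s).1 (pt (E s) (if ε then 0 else 1)) := by
    rintro (_ | _) s
    · exact (P.apply_target g s).trans (hg s 1)
    · exact (P.apply_source g s).trans (hg s 0)
  have hen1 : ∀ ε s, e.symm (en ε s).1 = (E s).1 := by
    rintro (_ | _) s
    · show e.symm (P.target s).1 = e.symm s.1
      unfold PolygonalPresentation.target; split_ifs <;> rfl
    · show e.symm (P.source s).1 = e.symm s.1
      unfold PolygonalPresentation.source; split_ifs <;> rfl
  have hpairq : ∀ x, P.pairing (E.symm (q x)) = E.symm (p x) := fun x => by
    apply E.injective; rw [hEpair, E.apply_symm_apply, E.apply_symm_apply, prq]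
  have hpairp : ∀ x, P.pairing (E.symm (p x)) = E.symm (q x) := fun x => by
    apply E.injective; rw [hEpair, E.apply_symm_apply, E.apply_symm_apply, prp]
  have hpair : ∀ s : P.Side, (∃ x, s = E.symm (p x)) ∨ (∃ x, s = E.symm (q x)) ∨
      P.pairing s = s := by
    intro s
    rcases cases_side (E s) with ⟨x, h⟩ | ⟨x, h⟩ | h
    · exact Or.inl ⟨x, by rw [← h, E.symm_apply_apply]⟩
    · exact Or.inr (Or.inl ⟨x, by rw [← h, E.symm_apply_apply]⟩)
    · exact Or.inr (Or.inr (E.injective (by rw [hEpair, h])))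
  -- The ends of `q x` are merged with those of `p x`. By `harc` the ends of all the `q x` are
  -- distinct, and by `hpq` none is a corner on the `p` side.
  have hV : Nat.card P.Vertex + Nat.card (X × Bool) = Nat.card P.Corner := by
    refine Nat.card_quot_add_card (w := fun i : X × Bool => en i.2 (E.symm (q i.1)))
      (w' := fun i : X × Bool => en i.2 (E.symm (p i.1))) ?_ ?_ ?_ ?_
    · rintro ⟨x, ε⟩ ⟨x', ε'⟩ h
      have h1 := hen ε (E.symm (q x))
      have h2 := hen ε' (E.symm (q x'))
      simp only at h
      rw [h, h2, E.apply_symm_apply, E.apply_symm_apply, hptq, hptq] at h1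
      obtain ⟨h3, h4⟩ := harc _ _ _ _ h1
      rw [h3]
      cases ε <;> cases ε' <;> simp at h4 ⊢
    · rintro ⟨x, ε⟩ ⟨x', ε'⟩ h
      have h1 := hen1 ε (E.symm (p x))
      have h2 := hen1 ε' (E.symm (q x'))
      simp only at h
      rw [h, h2, E.apply_symm_apply, E.apply_symm_apply] at h1
      exact hpq _ _ h1.symm
    · rintro ⟨x, _ | _⟩
      · exact ⟨E.symm (q x), Or.inr ⟨rfl, by rw [hpairq]; rfl⟩⟩
      · exact ⟨E.symm (q x), Or.inl ⟨rfl, by rw [hpairq]; rfl⟩⟩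
    · have key : ∀ ε (s : P.Side), en ε s = en ε (P.pairing s) ∨ ∃ i : X × Bool,
          (en ε s = en i.2 (E.symm (q i.1)) ∧ en ε (P.pairing s) = en i.2 (E.symm (p i.1))) ∨
          (en ε s = en i.2 (E.symm (p i.1)) ∧ en ε (P.pairing s) = en i.2 (E.symm (q i.1))) := by
        intro ε s
        rcases hpair s with ⟨x, rfl⟩ | ⟨x, rfl⟩ | h
        · exact Or.inr ⟨(x, ε), Or.inr ⟨rfl, by rw [hpairp]⟩⟩
        · exact Or.inr ⟨(x, ε), Or.inl ⟨rfl, by rw [hpairq]⟩⟩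
        · exact Or.inl (by rw [h])
      rintro _ _ ⟨s, ⟨rfl, rfl⟩ | ⟨rfl, rfl⟩⟩
      · exact key true s
      · exact key false s
  have hqinj : Function.Injective q := fun x x' h =>
    (harc x x' 0 0 (by rw [← hptq, ← hptq, h])).1
  have hA : Nat.card P.Edge + Nat.card X = Nat.card P.Side := by
    refine Nat.card_quot_add_card (w := fun x => E.symm (q x)) (w' := fun x => E.symm (p x))
      (E.symm.injective.comp hqinj) (fun x x' h => hpq' _ _ (E.symm.injective h))
      (fun x => (hpairq x).symm) ?_
    rintro s _ rfl
    rcases hpair s with ⟨x, rfl⟩ | ⟨x, rfl⟩ | h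
    · exact Or.inr ⟨x, Or.inr ⟨rfl, hpairp x⟩⟩
    · exact Or.inr ⟨x, Or.inl ⟨rfl, hpairq x⟩⟩
    · exact Or.inl h.symm
  rw [Nat.card_prod] at hV
  have hb : Nat.card Bool = 2 := by simp
  rw [hb] at hV
  -- Corners and sides cancel, leaving `|Φ| - 2|X| + |X|`.
  have hVA : Nat.card P.Corner = Nat.card P.Side := rfl
  show (Nat.card P.Vertex : ℤ) - Nat.card P.Edge + (Nat.card Φ : ℤ) = _
  omega

/-! ### Surfaces built from disks and bands. -/

/-- The square is a bounded convex set with interior, so a homeomorphism of the plane takes it to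
the disk and its frontier to the circle. -/
theorem exists_square_homeomorph_disk : ∃ κ : unitInterval × unitInterval ≃ₜ Disk,
    ∀ s t : unitInterval, s = 0 ∨ s = 1 → ‖(κ (s, t) : ℂ)‖ = 1 := by
  let Q : Set ℂ := Set.Icc 0 1 ×ℂ Set.Icc 0 1
  have hconv : Convex ℝ Q := ((convex_Icc (0 : ℝ) 1).linear_preimage Complex.reLm).inter
    ((convex_Icc (0 : ℝ) 1).linear_preimage Complex.imLm)
  obtain ⟨h, -, h2, h3⟩ := exists_homeomorph_image_interior_closure_frontier_eq_unitBall hconv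
    (by rw [Complex.interior_reProdIm, interior_Icc]; simp)
    ((Metric.isBounded_Icc _ _).reProdIm (Metric.isBounded_Icc _ _))
  rw [Complex.closure_reProdIm, isClosed_Icc.closure_eq] at h2
  rw [Complex.frontier_reProdIm, isClosed_Icc.closure_eq, frontier_Icc zero_le_one] at h3
  let f : unitInterval × unitInterval → Disk := fun p => ⟨h ⟨p.1, p.2⟩, by
    rw [← h2]; exact ⟨_, ⟨p.1.2, p.2.2⟩, rfl⟩⟩
  have hf : Continuous f := by
    refine Continuous.subtype_mk (h.continuous.comp ?_) _
    have : Continuous fun p : unitInterval × unitInterval => ((p.1 : ℝ) : ℂ) + (p.2 : ℝ) * Complex.I := by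
      fun_prop
    convert this using 2 with p
    exact Complex.mk_eq_add_mul_I _ _
  have hfb : Function.Bijective f := by
    constructor
    · rintro ⟨s, t⟩ ⟨s', t'⟩ e
      have e1 := h.injective (congrArg Subtype.val e)
      exact Prod.ext (Subtype.ext (congrArg Complex.re e1)) (Subtype.ext (congrArg Complex.im e1))
    · rintro ⟨z, hz⟩
      rw [← h2] at hz
      obtain ⟨w, ⟨hw1, hw2⟩, rfl⟩ := hz
      exact ⟨(⟨w.re, hw1⟩, ⟨w.im, hw2⟩), rfl⟩
  refine ⟨hf.homeoOfEquivCompactToT2 (f := Equiv.ofBijective f hfb), fun s t hs => ?_⟩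
  rw [← mem_sphere_zero_iff_norm, ← h3]
  refine ⟨⟨s, t⟩, Or.inr ⟨?_, t.2⟩, rfl⟩
  rcases hs with rfl | rfl <;> simp

namespace DiskBandDecomposition

variable {F : Set E3} {d b : ℕ}

/-- Each short side of a band is an arc on the boundary circle of one disk. -/
theorem exists_arc (D : DiskBandDecomposition F d b) (j : Fin b) (s : unitInterval) (hs : s = 0 ∨ s = 1) :
    ∃ (i : Fin d) (α : unitInterval → Disk), Continuous α ∧
      ∀ t, ‖(α t : ℂ)‖ = 1 ∧ D.band j (s, t) = D.disk i (α t) := by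
  choose a z hz hza using fun t => D.short_side j s t hs
  have hband : Continuous fun t => D.band j (s, t) :=
    (D.isEmbedding_band j).continuous.comp (by fun_prop)
  -- The disks are compact and disjoint, so the finitely many fibres of `a` are closed and `a` is
  -- constant on the interval.
  have hpre : ∀ i, a ⁻¹' {i} = (fun t => D.band j (s, t)) ⁻¹' Set.range (D.disk i) := by
    intro i
    ext t
    constructor
    · rintro rfl
      exact ⟨z t, (hza t).symm⟩
    · rintro ⟨w, hw⟩
      by_contra hne
      exact Set.disjoint_left.1 (D.disjoint_disks _ _ hne) ⟨z t, rfl⟩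
        ⟨w, hw.trans (hza t)⟩
  have hclosed : ∀ i, IsClosed (a ⁻¹' {i}) := fun i => by
    rw [hpre]
    exact (isCompact_range (D.isEmbedding_disk i).continuous).isClosed.preimage hband
  have hac : Continuous a := by
    refine continuous_iff_isClosed.2 fun T _ => ?_
    rw [← Set.biUnion_preimage_singleton]
    exact T.toFinite.isClosed_biUnion fun i _ => hclosed i
  have ha : ∀ t, a t = a 0 := fun t =>
    PreconnectedSpace.constant inferInstance hac
  refine ⟨a 0, z, ?_, fun t => ⟨hz t, by rw [hza, ha t]⟩⟩
  rw [(D.isEmbedding_disk (a 0)).continuous_iff]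
  convert hband using 2 with t
  exact (by rw [hza, ha t] : D.disk (a 0) (z t) = D.band j (s, t))

/-- A surface built from `d` disks and `b` bands has a polygonal presentation with Euler
characteristic `d - b`. -/
theorem exists_presentation (D : DiskBandDecomposition F d b) :
    ∃ P : PolygonalPresentation, P.Presents F ∧ P.eulerChar = (d : ℤ) - b := by
  classical
  obtain ⟨κ, hκ⟩ := exists_square_homeomorph_disk
  let u : Bool → unitInterval := fun ε => if ε then 1 else 0
  have hu : ∀ ε, u ε = 0 ∨ u ε = 1 := fun ε => by cases ε <;> simp [u]
  have huinj : Function.Injective u := by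
    rintro (_ | _) (_ | _) h <;> simp [u] at h ⊢
  choose a α hαc hα using fun x : Fin b × Bool => D.exists_arc x.1 (u x.2) (hu x.2)
  have hband : ∀ (j j' : Fin b) (y y' : unitInterval × unitInterval), D.band j y = D.band j' y' →
      j = j' ∧ y = y' := by
    intro j j' y y' e
    have hj : j = j' := by
      by_contra hne
      exact Set.disjoint_left.1 (D.disjoint_bands _ _ hne) ⟨y, rfl⟩ ⟨y', e.symm⟩
    subst hj
    exact ⟨rfl, (D.isEmbedding_band j).injective e⟩
  have hdisk : ∀ (i i' : Fin d) (z z' : Disk), D.disk i z = D.disk i' z' → i = i' ∧ z = z' := by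
    intro i i' z z' e
    have hi : i = i' := by
      by_contra hne
      exact Set.disjoint_left.1 (D.disjoint_disks _ _ hne) ⟨z, rfl⟩ ⟨z', e.symm⟩
    subst hi
    exact ⟨rfl, (D.isEmbedding_disk i).injective e⟩
  have hs : ∀ (x x' : Fin b × Bool) (t t' : unitInterval),
      D.band x.1 (u x.2, t) = D.band x'.1 (u x'.2, t') → x = x' ∧ t = t' := by
    rintro ⟨j, ε⟩ ⟨j', ε'⟩ t t' e
    obtain ⟨h1, h2⟩ := hband _ _ _ _ e
    simp only [Prod.mk.injEq] at h1 h2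
    exact ⟨Prod.ext h1 (huinj h2.1), h2.2⟩
  -- Each disk becomes a polygon with the short sides attached to it among its sides.
  choose N₁ hN₁ C₁ side₁ o₁ hC₁ hC₁b hC₁α using fun i : Fin d =>
    exists_polygon_parametrization (fun x : {x : Fin b × Bool // a x = i} => α x)
      (fun x => hαc x) (fun x t => (hα x t).1) (fun x x' t t' e => by
        obtain ⟨h1, h2⟩ := hs x x' t t' (by
          rw [(hα _ _).2, (hα _ _).2, x.2, x'.2]; exact congrArg _ e)
        exact ⟨Subtype.ext h1, h2⟩)
  -- One polygon model, from the square, serves for all bands.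
  obtain ⟨N₂, hN₂, C₂, side₂, o₂, hC₂, hC₂b, hC₂α⟩ :=
    exists_polygon_parametrization (fun (ε : Bool) t => κ (u ε, t))
      (fun ε => κ.continuous.comp (by fun_prop)) (fun ε t => hκ _ _ (hu ε))
      (fun ε ε' t t' e => by
        have h := κ.injective e
        simp only [Prod.mk.injEq] at h
        exact ⟨huinj h.1, h.2⟩)
  let N : Fin d ⊕ Fin b → ℕ := Sum.elim N₁ fun _ => N₂
  have hN : ∀ i, NeZero (N i) := by
    rintro (i | j)
    · exact hN₁ i
    · exact hN₂
  let ψ₀ : Fin d ⊕ Fin b → Disk → E3 :=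
    Sum.elim (fun i z => D.disk i (C₁ i z)) fun j z => D.band j (κ.symm (C₂ z))
  have hψ₀c : ∀ i, Continuous (ψ₀ i) := by
    rintro (i | j)
    · exact (D.isEmbedding_disk i).continuous.comp (hC₁ i)
    · exact (D.isEmbedding_band j).continuous.comp (κ.symm.continuous.comp hC₂)
  have hψ₀inj : ∀ i, Function.Injective (ψ₀ i) := by
    rintro (i | j)
    · exact (D.isEmbedding_disk i).injective.comp (hC₁b i).1
    · exact (D.isEmbedding_band j).injective.comp (κ.symm.injective.comp hC₂b.1)
  have hmem : ∀ i z, ψ₀ i z ∈ F := by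
    intro i z
    rw [D.union_eq]
    rcases i with i | j
    · exact Or.inl (Set.mem_iUnion.2 ⟨i, _, rfl⟩)
    · exact Or.inr (Set.mem_iUnion.2 ⟨j, _, rfl⟩)
  have hsurj : ∀ y ∈ F, ∃ i z, ψ₀ i z = y := by
    intro y hy
    rw [D.union_eq] at hy
    rcases hy with hy | hy
    · obtain ⟨i, w, rfl⟩ := Set.mem_iUnion.1 hy
      obtain ⟨z, rfl⟩ := (hC₁b i).2 w
      exact ⟨Sum.inl i, z, rfl⟩
    · obtain ⟨j, w, rfl⟩ := Set.mem_iUnion.1 hy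
      obtain ⟨z, hz⟩ := hC₂b.2 (κ w)
      refine ⟨Sum.inr j, z, ?_⟩
      show D.band j (κ.symm (C₂ z)) = D.band j w
      rw [hz, κ.symm_apply_apply]
  let p : Fin b × Bool → Σ i, Fin (N i) := fun x => ⟨Sum.inl (a x), side₁ (a x) ⟨x, rfl⟩⟩
  let q : Fin b × Bool → Σ i, Fin (N i) := fun x => ⟨Sum.inr x.1, side₂ x.2⟩
  have hq : ∀ x t, ψ₀ (q x).1 (polygonPoint _ (q x).2 (o₂ x.2) t) = D.band x.1 (u x.2, t) := by
    intro x t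
    show D.band x.1 (κ.symm (C₂ (polygonPoint N₂ (side₂ x.2) (o₂ x.2) t))) = _
    rw [hC₂α, κ.symm_apply_apply]
  have hp : ∀ x t, ψ₀ (p x).1 (polygonPoint _ (p x).2 (o₁ (a x) ⟨x, rfl⟩) t) =
      D.band x.1 (u x.2, t) := by
    intro x t
    show D.disk (a x) (C₁ (a x) (polygonPoint (N₁ (a x)) (side₁ (a x) ⟨x, rfl⟩)
      (o₁ (a x) ⟨x, rfl⟩) t)) = _
    rw [hC₁α, (hα x t).2]
  have hmeet : ∀ (i : Fin d) (j : Fin b) (z z' : Disk), ψ₀ (Sum.inl i) z = ψ₀ (Sum.inr j) z' →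
      ∃ x t, (Sum.inl i : Fin d ⊕ Fin b) = (p x).1 ∧
        z = polygonPoint _ (p x).2 (o₁ (a x) ⟨x, rfl⟩) t ∧
        (Sum.inr j : Fin d ⊕ Fin b) = (q x).1 ∧ z' = polygonPoint _ (q x).2 (o₂ x.2) t := by
    intro i j z z' e
    have e' : D.band j (κ.symm (C₂ z')) = D.disk i (C₁ i z) := e.symm
    -- The contact point lies on a short side; its height in the band is the common parameter on
    -- both polygon sides.
    obtain ⟨ε, hε⟩ : ∃ ε, u ε = (κ.symm (C₂ z')).1 := by
      rcases D.meets_only_short_side j _ _ i _ e' with h | h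
      · exact ⟨false, h.symm⟩
      · exact ⟨true, h.symm⟩
    have h1 : κ.symm (C₂ z') = (u ε, (κ.symm (C₂ z')).2) := Prod.ext hε.symm rfl
    refine ⟨(j, ε), (κ.symm (C₂ z')).2, ?_⟩
    have h2 : ψ₀ (Sum.inr j) z' = ψ₀ (Sum.inr j)
        (polygonPoint N₂ (side₂ ε) (o₂ ε) (κ.symm (C₂ z')).2) := by
      refine Eq.trans ?_ (hq (j, ε) _).symm
      show D.band j (κ.symm (C₂ z')) = _
      rw [h1]
    have h3 : i = a (j, ε) := by
      have h4 := (hα (j, ε) (κ.symm (C₂ z')).2).2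
      rw [← h1, e'] at h4
      exact (hdisk _ _ _ _ h4).1
    subst h3
    refine ⟨rfl, hψ₀inj (Sum.inl (a (j, ε))) ?_, rfl, hψ₀inj _ h2⟩
    rw [e, h2]
    exact (hq (j, ε) _).trans (hp (j, ε) _).symm
  obtain ⟨P, hP, hPχ⟩ := exists_presentation_of_gluing (Y := F) N
    (fun i z => ⟨ψ₀ i z, hmem i z⟩) (fun i => Continuous.subtype_mk (hψ₀c i) _)
    (fun i z z' e => hψ₀inj i (congrArg Subtype.val e))
    (fun y => by
      obtain ⟨i, z, h⟩ := hsurj y y.2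
      exact ⟨i, z, Subtype.ext h⟩)
    p q (fun x => o₁ (a x) ⟨x, rfl⟩) (fun x => o₂ x.2) (fun x x' => Sum.inl_ne_inr)
    (fun x t => Subtype.ext ((hp x t).trans (hq x t).symm))
    (fun x x' t t' e => by
      have e' := congrArg Subtype.val e
      simp only [hq] at e'
      exact hs x x' t t' e')
    (by
      rintro (i | j) (i' | j') z z' hne e
      · exact absurd (congrArg Sum.inl (hdisk _ _ _ _ (congrArg Subtype.val e)).1) hne
      · obtain ⟨x, t, h⟩ := hmeet i j' z z' (congrArg Subtype.val e)
        exact ⟨x, t, Or.inl h⟩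
      · obtain ⟨x, t, h⟩ := hmeet i' j z' z (congrArg Subtype.val e).symm
        exact ⟨x, t, Or.inr h⟩
      · exact absurd (congrArg Sum.inr (hband _ _ _ _ (congrArg Subtype.val e)).1) hne)
  refine ⟨P, hP, hPχ.trans ?_⟩
  simp only [Nat.card_eq_fintype_card, Fintype.card_sum, Fintype.card_prod, Fintype.card_fin,
    Fintype.card_bool]
  push_cast; ring

end DiskBandDecomposition

theorem mainTheorem6 (F : Set E3)
    [ChartedSpace (EuclideanHalfSpace 2) F]
    (hcompact : IsCompact F)
    (horientable : IsOrientableSurface F)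
    (hboundary : IsConnected ((𝓡∂ 2).boundary F))
    (d b : ℕ)
    (hF : Nonempty (DiskBandDecomposition F d b)) :
    HasEulerChar F ((d : ℤ) - (b : ℤ)) := by
  obtain ⟨D⟩ := hF
  obtain ⟨Q, ⟨hQ⟩, hχ⟩ := D.exists_presentation
  refine ⟨⟨Q, ⟨hQ⟩⟩, ?_⟩
  rintro P ⟨hP⟩
  rw [← hχ]
  exact PolygonalPresentation.eulerChar_eq_of_homeomorph (hP.trans hQ.symm)
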